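/- Let $V$ be a nonzero finite-dimensional vector space over an arbitrary field $F$, let $n=\dim V$, and let $T(V)$ be the Tits building of $V$, i.e. the nerve of the poset of proper nonzero linear subspaces of $V$. Let $\mathrm{St}(V)=\widetilde H_{n-2}(T(V);\mathbb Z)$ be the Steinberg module with its natural action of $\mathrm{GL}(V)$. Since $T(V)$ has no nondegenerate simplices of dimension greater than $n-2$, $\mathrm{St}(V)$ is the subgroup of cycles in the group $\widetilde C_{n-2}(T(V))$ of augmented simplicial chains, which is the free abelian group on the set of full flags $0<W_1<\dots<W_{n-1}<V$ (for $n=1$ it is $\mathbb Z$, spanned by the empty flag, and $\mathrm{St}(V)=\mathbb Z$). Let $\langle-,-\rangle$ be the restriction to $\mathrm{St}(V)$ of the bilinear pairing on $\widetilde C_{n-2}(T(V))$ for which the full flags form an orthonormal basis. Then $\langle-,-\rangle$ is $\mathrm{GL}(V)$-invariant, and the map that it induces on coinvariants of the diagonal action, $$(\mathrm{St}(V)\otimes_{\mathbb Z}\mathrm{St}(V))_{\mathrm{GL}(V)}\longrightarrow\mathbb Z,\qquad [x\otimes y]\longmapsto\langle x,y\rangle,$$ is an isomorphism. -/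

import Mathlib

open scoped TensorProduct

noncomputable section

namespace Steinberg

universe u v

section Poset

variable (P : Type v) [PartialOrder P]

/-- The augmented simplicial chains, with integer coefficients, of the nerve of a poset `P`, in
degree `k - 1`: the free abelian group on the strict chains `x₀ < ⋯ < x_{k-1}` of `k` elements
of `P`. For `k = 0` this is `ℤ`, spanned by the empty chain, in degree `-1`. -/
abbrev Chains (k : ℕ) : Type v := (Fin k ↪o P) →₀ ℤ

/-- The simplicial boundary from degree `k` to degree `k - 1`, the alternating sum over `i` of the
faces that omit the `i`-th vertex. For `k = 0` it is the augmentation. -/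
def boundary (k : ℕ) : Chains P (k + 1) →ₗ[ℤ] Chains P k :=
  Finsupp.linearCombination ℤ fun c : Fin (k + 1) ↪o P =>
    ∑ i : Fin (k + 1),
      Finsupp.single ((Fin.succAboveOrderEmb i).trans c) ((-1 : ℤ) ^ (i : ℕ))

/-- The reduced cycles in degree `k - 1`. In degree `-1` every chain is a cycle. -/
def cycles : (k : ℕ) → Submodule ℤ (Chains P k)
  | 0 => ⊤
  | k + 1 => LinearMap.ker (boundary P k)

/-- The boundaries in degree `k - 1`. -/
def boundaries (k : ℕ) : Submodule ℤ (Chains P k) := LinearMap.range (boundary P k)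

/-- The reduced homology, in degree `k - 1`, of the nerve of `P`: cycles modulo boundaries. -/
abbrev ReducedHomology (k : ℕ) : Type v :=
  cycles P k ⧸ (boundaries P k).comap (cycles P k).subtype

/-- The integer-valued bilinear pairing on chains for which the strict chains of length `k` are
orthonormal: `⟨x, y⟩ = ∑ x_c y_c`. -/
def chainPairing (k : ℕ) : Chains P k →ₗ[ℤ] Chains P k →ₗ[ℤ] ℤ :=
  Finsupp.linearCombination ℤ fun c : Fin k ↪o P => Finsupp.lapply c

theorem chainPairing_single (k : ℕ) (c c' : Fin k ↪o P) (a b : ℤ) :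
    chainPairing P k (Finsupp.single c a) (Finsupp.single c' b) =
      a * (Finsupp.single c' b) c := by
  simp [chainPairing]

variable {P}

/-- The map on chains induced by an order embedding of `P` into itself. -/
def chainMap (e : P ↪o P) (k : ℕ) : Chains P k →ₗ[ℤ] Chains P k :=
  Finsupp.lmapDomain ℤ ℤ fun c : Fin k ↪o P => c.trans e

theorem chainMap_single (e : P ↪o P) (k : ℕ) (c : Fin k ↪o P) (a : ℤ) :
    chainMap e k (Finsupp.single c a) = Finsupp.single (c.trans e) a := by
  simp [chainMap]

theorem boundary_chainMap (e : P ↪o P) (k : ℕ) (x : Chains P (k + 1)) :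
    boundary P k (chainMap e (k + 1) x) = chainMap e k (boundary P k x) := by
  have h : boundary P k ∘ₗ chainMap e (k + 1) = chainMap e k ∘ₗ boundary P k := by
    ext c : 2
    simp only [LinearMap.comp_apply, Finsupp.lsingle_apply, chainMap_single]
    simp only [boundary, Finsupp.linearCombination_single, one_smul, map_sum, chainMap_single]
    rfl
  exact LinearMap.congr_fun h x

theorem chainMap_mem_cycles (e : P ↪o P) (k : ℕ) (x : Chains P k) (hx : x ∈ cycles P k) :
    chainMap e k x ∈ cycles P k := by
  cases k with
  | zero => exact Submodule.mem_top
  | succ k =>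
    have hx' : boundary P k x = 0 := hx
    change boundary P k (chainMap e (k + 1) x) = 0
    rw [boundary_chainMap, hx', map_zero]

theorem chainPairing_chainMap (e : P ↪o P) (k : ℕ) (x y : Chains P k) :
    chainPairing P k (chainMap e k x) (chainMap e k y) = chainPairing P k x y := by
  have hinj : Function.Injective fun c : Fin k ↪o P => c.trans e := by
    intro c c' h
    ext i
    exact e.injective (DFunLike.congr_fun h i)
  have h : (chainPairing P k).compl₁₂ (chainMap e k) (chainMap e k) = chainPairing P k := by
    ext c c'
    classical
    simp [chainMap_single, chainPairing_single, Finsupp.single_apply, hinj.eq_iff]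
  exact LinearMap.congr_fun (LinearMap.congr_fun h x) y

end Poset

section Building

variable (F : Type u) (V : Type v) [Field F] [AddCommGroup V] [Module F V]

/-- The Tits building of `V`: the poset of proper nonzero linear subspaces of `V`. -/
abbrev TitsBuilding : Type v := {W : Submodule F V // W ≠ ⊥ ∧ W ≠ ⊤}

/-- Full flags `0 < W₁ < ⋯ < W_{n-1} < V`, with `n = dim V`: the simplices of dimension `n - 2` of
the Tits building. -/
abbrev FullFlag : Type v := Fin (Module.finrank F V - 1) ↪o TitsBuilding F V

/-- The Steinberg module `St(V)`: the reduced cycles of degree `dim V - 2` of the Tits building.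
As there are no simplices of higher dimension, this is the reduced homology in that degree; see
`stEquivReducedHomology`. -/
abbrev St : Submodule ℤ (FullFlag F V →₀ ℤ) :=
  cycles (TitsBuilding F V) (Module.finrank F V - 1)

theorem boundaries_top_eq_bot [FiniteDimensional F V] [Nontrivial V] :
    boundaries (TitsBuilding F V) (Module.finrank F V - 1) = ⊥ := by
  have hn : 0 < Module.finrank F V := Module.finrank_pos
  have hempty : IsEmpty (Fin (Module.finrank F V - 1 + 1) ↪o TitsBuilding F V) := by
    refine ⟨fun c => ?_⟩
    have key : ∀ m : ℕ, ∀ hm : m < Module.finrank F V - 1 + 1,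
        m + 1 ≤ Module.finrank F (c ⟨m, hm⟩).1 := by
      intro m
      induction m with
      | zero =>
        intro hm
        exact Submodule.one_le_finrank_iff.2 (c ⟨0, hm⟩).2.1
      | succ m ih =>
        intro hm
        have h1 := ih (by omega)
        have h2 : c ⟨m, by omega⟩ < c ⟨m + 1, hm⟩ :=
          c.strictMono (Fin.mk_lt_mk.2 (Nat.lt_succ_self m))
        have h3 := Submodule.finrank_lt_finrank_of_lt (Subtype.coe_lt_coe.2 h2)
        omega
    have h1 := key (Module.finrank F V - 1) (by omega)
    have h2 := Submodule.finrank_lt (c ⟨Module.finrank F V - 1, by omega⟩).2.2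
    omega
  rw [boundaries, LinearMap.range_eq_bot]
  ext c
  exact hempty.elim c

/-- The Steinberg module is the reduced homology of the Tits building in degree `dim V - 2`. -/
def stEquivReducedHomology [FiniteDimensional F V] [Nontrivial V] :
    ReducedHomology (TitsBuilding F V) (Module.finrank F V - 1) ≃ₗ[ℤ] St F V :=
  Submodule.quotEquivOfEqBot _ (by
    rw [boundaries_top_eq_bot, Submodule.comap_bot, Submodule.ker_subtype])

variable {F V}

/-- The action of `g ∈ GL(V)` on the Tits building, `W ↦ g(W)`. -/
def buildingMap (g : LinearMap.GeneralLinearGroup F V) : TitsBuilding F V ↪o TitsBuilding F V :=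
  OrderEmbedding.ofMapLEIff
    (fun W => ⟨W.1.map (LinearMap.GeneralLinearGroup.toLinearEquiv g : V →ₗ[F] V),
      fun h => W.2.1 ((map_eq_bot_iff (Submodule.orderIsoMapComap
        (LinearMap.GeneralLinearGroup.toLinearEquiv g))).1 h),
      fun h => W.2.2 ((map_eq_top_iff (Submodule.orderIsoMapComap
        (LinearMap.GeneralLinearGroup.toLinearEquiv g))).1 h)⟩)
    (fun W W' => Submodule.map_le_map_iff_of_injective (LinearEquiv.injective _) W.1 W'.1)

theorem buildingMap_one : buildingMap (1 : LinearMap.GeneralLinearGroup F V) =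
    RelEmbedding.refl _ := by
  ext W : 2
  exact Submodule.map_id W.1

theorem buildingMap_mul (g h : LinearMap.GeneralLinearGroup F V) :
    buildingMap (g * h) = (buildingMap h).trans (buildingMap g) := by
  ext W : 2
  exact Submodule.map_comp _ _ W.1

variable (F V)

/-- The action of `GL(V)` on the Steinberg module, by `g · (W₁ < ⋯) = (g W₁ < ⋯)` on flags. -/
def stRep : Representation ℤ (LinearMap.GeneralLinearGroup F V) (St F V) where
  toFun g := (chainMap (buildingMap g) _).restrict (chainMap_mem_cycles (buildingMap g) _)
  map_one' := by
    ext1 x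
    apply Subtype.ext
    change chainMap (buildingMap 1) _ x.1 = x.1
    rw [buildingMap_one]
    exact LinearMap.congr_fun (Finsupp.lmapDomain_id ℤ ℤ) x.1
  map_mul' g h := by
    ext1 x
    apply Subtype.ext
    change chainMap (buildingMap (g * h)) _ x.1 =
      chainMap (buildingMap g) _ (chainMap (buildingMap h) _ x.1)
    rw [buildingMap_mul]
    exact LinearMap.congr_fun (Finsupp.lmapDomain_comp ℤ ℤ
      (fun c : FullFlag F V => c.trans (buildingMap h))
      (fun c : FullFlag F V => c.trans (buildingMap g))) x.1

/-- The pairing on the Steinberg module: the restriction of the pairing on the free abelian group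
on the full flags in which the full flags are an orthonormal basis. -/
def stPairing : St F V →ₗ[ℤ] St F V →ₗ[ℤ] ℤ :=
  (chainPairing (TitsBuilding F V) (Module.finrank F V - 1)).domRestrict₁₂ (St F V) (St F V)

theorem stPairing_invariant (g : LinearMap.GeneralLinearGroup F V) (x y : St F V) :
    stPairing F V (stRep F V g x) (stRep F V g y) = stPairing F V x y :=
  chainPairing_chainMap (buildingMap g) _ x.1 y.1

/-- The map `(St(V) ⊗ St(V))_{GL(V)} → ℤ` induced by the pairing, where `GL(V)` acts diagonally on
the tensor product. -/
def coinvariantsPairing : ((stRep F V).tprod (stRep F V)).Coinvariants →ₗ[ℤ] ℤ :=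
  Representation.Coinvariants.lift _ (TensorProduct.lift (stPairing F V)) fun g =>
    TensorProduct.ext' fun x y => stPairing_invariant F V g x y

end Building

end Steinberg

end

/-! Call two biadditive forms equal if they agree on cycles, and let `A` be any abelian group. The
point is that every `GL(V)`-invariant form `St(V) × St(V) → A` is `⟨-,-⟩ • r` for some `r : A`.
Taking for `A` the coinvariants themselves, with the tautological form, gives `[x ⊗ y] = ⟨x, y⟩ •
r`. Two cycles with exactly one common flag can be chosen with pairing `1`, and bijectivity follows.

Invariant forms are classified by induction on the dimension of a subspace `K`, for a stronger
statement that allows less symmetry (`invariantsArePairings`). If `B` is invariant only under those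
automorphisms of `K` that preserve a functional up to a nonzero scalar, then `B(x, y) = ∑ x_W y_W
c(W)`, where `c(W)` depends only on the last index at which the flag `W` lies in the kernel of the
functional.

Let `ψ e = 1` and `H = K ∩ ker ψ`. Suspending a cycle of `H` by the line of `e` gives a cycle of
`K`. `St(K)` is spanned by suspensions of `St(H)` by varying vectors `e'` with `ψ e' = 1`
(`flagCycles_le_iSup_vector`), and also by suspensions of varying complements of a fixed line
(`flagCycles_le_iSup_dual`). The group moves every `e'` to `e`, and the complements are the images
of `H` under the shears `v ↦ v + φ(v) e` with `φ e = 0`. So `B` is determined by the forms `B_φ(x,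
y) = B(susp x, susp (shear_φ y))` on `St(H)`. Each is invariant under the automorphisms of `H` that
preserve `φ` up to scalar, hence is known by induction, and conjugation makes its weights `c`
independent of `φ`. A pairing on `K` with weights `d` restricts in the same way to weights `∑_{i ≤
j} d i` (`weightedPairing_susp`), so solving `∑_{i ≤ j} d i = c j` exhibits `B` as a weighted
pairing.

If the functional vanishes on `K`, then `B` is invariant under all of `GL(K)`. An auxiliary `ψ`
still yields weights `d`, and evaluating on translates of a pair of cycles with one common flag
shows that `d` is constant. -/

noncomputable section

namespace Steinberg

open Module

variable {F V : Type*} [Field F] [AddCommGroup V] [Module F V]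

/-! ### Flags as sequences of subspaces, and suspension from a hyperplane -/

section Flags

/-- `W` is the sequence `0 = W 0 < W 1 < ⋯ < W m = K = W (m + 1) = ⋯` given by a full flag of the
subspace `K`, with `m = dim K`. -/
structure IsFlag (K : Submodule F V) (W : ℕ → Submodule F V) : Prop where
  mono : Monotone W
  le : ∀ j, W j ≤ K
  rank : ∀ j, finrank F (W j) = min j (finrank F K)

/-- Forget the `i`-th term of a sequence of subspaces. -/
def erase (i : ℕ) (W : ℕ → Submodule F V) : ℕ → Submodule F V := Function.update W i ⊥

/-- The Steinberg module of a subspace `K` of `V`, realised on sequences of subspaces of `V`. -/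
def flagCycles (K : Submodule F V) : Submodule ℤ ((ℕ → Submodule F V) →₀ ℤ) :=
  Finsupp.supported ℤ ℤ {W | IsFlag K W} ⊓
    ⨅ i : ℕ, ⨅ _ : 0 < i ∧ i < finrank F K, LinearMap.ker (Finsupp.lmapDomain ℤ ℤ (erase i))

theorem mem_flagCycles {K : Submodule F V} {z : (ℕ → Submodule F V) →₀ ℤ} :
    z ∈ flagCycles K ↔ (∀ W ∈ z.support, IsFlag K W) ∧
      ∀ i, 0 < i → i < finrank F K → Finsupp.mapDomain (erase i) z = 0 := by
  simp only [flagCycles, Submodule.mem_inf, Finsupp.mem_supported, Set.subset_def,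
    Submodule.mem_iInf, LinearMap.mem_ker, Finsupp.lmapDomain_apply, and_imp, Finset.mem_coe,
    Set.mem_ofPred_eq]

/-- Lift a sequence of subspaces to one of length one more by adding `ℓ` after the `i`-th term. -/
def ins (ℓ : Submodule F V) (i : ℕ) (W : ℕ → Submodule F V) : ℕ → Submodule F V :=
  fun j => if j ≤ i then W j else W (j - 1) ⊔ ℓ

theorem ins_of_le (ℓ : Submodule F V) {i j : ℕ} (h : j ≤ i) (W : ℕ → Submodule F V) :
    ins ℓ i W j = W j := if_pos h

theorem ins_of_lt (ℓ : Submodule F V) {i j : ℕ} (h : i < j) (W : ℕ → Submodule F V) :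
    ins ℓ i W j = W (j - 1) ⊔ ℓ := if_neg h.not_ge

/-- The suspension of chains: the signed sum of all insertions of `ℓ`. -/
def susp (ℓ : Submodule F V) (m : ℕ) :
    ((ℕ → Submodule F V) →₀ ℤ) →ₗ[ℤ] ((ℕ → Submodule F V) →₀ ℤ) :=
  ∑ i ∈ Finset.range m, ((-1 : ℤ) ^ i) • Finsupp.lmapDomain ℤ ℤ (ins ℓ i)

/-- The map on chains induced by a linear endomorphism of `V`. -/
def act (g : V →ₗ[F] V) : ((ℕ → Submodule F V) →₀ ℤ) →ₗ[ℤ] ((ℕ → Submodule F V) →₀ ℤ) :=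
  Finsupp.lmapDomain ℤ ℤ fun W j => (W j).map g

theorem susp_apply (ℓ : Submodule F V) (m : ℕ) (x : (ℕ → Submodule F V) →₀ ℤ) :
    susp ℓ m x = ∑ i ∈ Finset.range m, ((-1 : ℤ) ^ i) • Finsupp.mapDomain (ins ℓ i) x := by
  simp only [susp, LinearMap.sum_apply, LinearMap.smul_apply, Finsupp.lmapDomain_apply]

theorem susp_single (ℓ : Submodule F V) (m : ℕ) (W : ℕ → Submodule F V) (a : ℤ) :
    susp ℓ m (Finsupp.single W a) =
      ∑ i ∈ Finset.range m, ((-1 : ℤ) ^ i) • Finsupp.single (ins ℓ i W) a := by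
  simp only [susp_apply, Finsupp.mapDomain_single]

theorem act_apply (g : V →ₗ[F] V) (x : (ℕ → Submodule F V) →₀ ℤ) :
    act g x = Finsupp.mapDomain (fun W j => (W j).map g) x := rfl

theorem act_single (g : V →ₗ[F] V) (W : ℕ → Submodule F V) (a : ℤ) :
    act g (Finsupp.single W a) = Finsupp.single (fun j => (W j).map g) a := by
  simp [act_apply]

theorem act_comp (g h : V →ₗ[F] V) (x : (ℕ → Submodule F V) →₀ ℤ) :
    act (g ∘ₗ h) x = act g (act h x) := by
  rw [act_apply, act_apply, act_apply, ← Finsupp.mapDomain_comp]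
  congr 1
  ext W j : 2
  exact Submodule.map_comp _ _ _

theorem act_susp (g : V →ₗ[F] V) (ℓ : Submodule F V) (m : ℕ)
    (x : (ℕ → Submodule F V) →₀ ℤ) : act g (susp ℓ m x) = susp (ℓ.map g) m (act g x) := by
  simp only [susp_apply, map_sum, map_smul, act_apply, ← Finsupp.mapDomain_comp]
  refine Finset.sum_congr rfl fun i _ => ?_
  congr 2
  ext W j : 2
  simp only [Function.comp_apply, ins]
  split_ifs
  · rfl
  · exact Submodule.map_sup _ _ _

theorem map_congr_of_le {g h : V →ₗ[F] V} {K W : Submodule F V} (hgh : ∀ v ∈ K, g v = h v)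
    (hW : W ≤ K) : W.map g = W.map h := by
  ext v
  simp only [Submodule.mem_map]
  exact exists_congr fun w => and_congr_right fun hw => by rw [hgh w (hW hw)]

theorem act_congr {g h : V →ₗ[F] V} {K : Submodule F V} (hgh : ∀ v ∈ K, g v = h v)
    {x : (ℕ → Submodule F V) →₀ ℤ} (hx : x ∈ flagCycles K) : act g x = act h x :=
  Finsupp.mapDomain_congr fun W hW =>
    funext fun j => map_congr_of_le hgh (((mem_flagCycles.1 hx).1 W hW).le j)

theorem act_eq_self {g : V →ₗ[F] V} {K : Submodule F V} (hg : ∀ v ∈ K, g v = v)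
    {x : (ℕ → Submodule F V) →₀ ℤ} (hx : x ∈ flagCycles K) : act g x = x := by
  rw [act_congr (h := LinearMap.id) hg hx, act_apply]
  simp only [Submodule.map_id]
  exact Finsupp.mapDomain_id

theorem finrank_map_of_injOn {g : V →ₗ[F] V} {K W : Submodule F V}
    (hg : ∀ v ∈ K, g v = 0 → v = 0) (hW : W ≤ K) : finrank F (W.map g) = finrank F W := by
  have hinj : Function.Injective (g.domRestrict W) := by
    rw [← LinearMap.ker_eq_bot, LinearMap.ker_eq_bot']
    intro v hv
    exact Subtype.ext (hg v.1 (hW v.2) hv)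
  rw [← LinearMap.range_domRestrict]
  exact LinearMap.finrank_range_of_inj hinj

theorem map_injective_of_injOn {g : V →ₗ[F] V} {K W W' : Submodule F V}
    (hg : ∀ v ∈ K, g v = 0 → v = 0) (hW : W ≤ K) (hW' : W' ≤ K) (h : W.map g = W'.map g) :
    W = W' := by
  have key : ∀ {A B : Submodule F V}, A ≤ K → B ≤ K → A.map g = B.map g → A ≤ B := by
    intro A B hA hB h a ha
    obtain ⟨b, hb, hba⟩ := Submodule.mem_map.1 (h ▸ Submodule.mem_map_of_mem (f := g) ha)
    have : b - a = 0 := hg _ (K.sub_mem (hB hb) (hA ha)) (by rw [map_sub, hba, sub_self])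
    rwa [← sub_eq_zero.1 this]
  exact le_antisymm (key hW hW' h) (key hW' hW h.symm)

theorem IsFlag.map {g : V →ₗ[F] V} {K K' : Submodule F V} (hK : ∀ v ∈ K, g v ∈ K')
    (hg : ∀ v ∈ K, g v = 0 → v = 0) (hr : finrank F K' = finrank F K)
    {W : ℕ → Submodule F V} (hW : IsFlag K W) : IsFlag K' fun j => (W j).map g where
  mono _ _ h := Submodule.map_mono (hW.mono h)
  le j := Submodule.map_le_iff_le_comap.2 fun v hv => hK v (hW.le j hv)
  rank j := by rw [finrank_map_of_injOn hg (hW.le j), hW.rank, hr]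

theorem act_mem {g : V →ₗ[F] V} {K K' : Submodule F V} (hK : ∀ v ∈ K, g v ∈ K')
    (hg : ∀ v ∈ K, g v = 0 → v = 0) (hr : finrank F K' = finrank F K)
    {x : (ℕ → Submodule F V) →₀ ℤ} (hx : x ∈ flagCycles K) : act g x ∈ flagCycles K' := by
  classical
  rw [mem_flagCycles] at hx ⊢
  refine ⟨fun W hW => ?_, fun i hi hi' => ?_⟩
  · obtain ⟨W, hW', rfl⟩ := Finset.mem_image.1 (Finsupp.mapDomain_support hW)
    exact (hx.1 W hW').map hK hg hr
  · have : (erase i ∘ fun W j => (W j).map g) =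
        (fun (W : ℕ → Submodule F V) j => (W j).map g) ∘ erase i := by
      ext W j : 2
      by_cases hj : j = i <;> simp [erase, hj]
    rw [act_apply, ← Finsupp.mapDomain_comp, this, Finsupp.mapDomain_comp, hx.2 i hi (hr ▸ hi'),
      Finsupp.mapDomain_zero]

theorem IsFlag.zero {K : Submodule F V} [FiniteDimensional F V] {W : ℕ → Submodule F V}
    (hW : IsFlag K W) : W 0 = ⊥ := by
  rw [← Submodule.finrank_eq_zero (R := F), hW.rank]
  simp

theorem IsFlag.top {K : Submodule F V} [FiniteDimensional F V] {W : ℕ → Submodule F V}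
    (hW : IsFlag K W) {j : ℕ} (hj : finrank F K ≤ j) : W j = K :=
  Submodule.eq_of_le_of_finrank_eq (hW.le j) (by rw [hW.rank, min_eq_right hj])

section Hyperplane

variable {ψ : Dual F V} {e : V}

theorem inf_ker_sup_span (he : ψ e = 1) {N : Submodule F V} (heN : e ∈ N) :
    (N ⊓ LinearMap.ker ψ) ⊔ Submodule.span F {e} = N := by
  refine le_antisymm (sup_le inf_le_left ((Submodule.span_singleton_le_iff_mem _ _).2 heN)) ?_
  intro v hv
  refine Submodule.mem_sup.2 ⟨v - ψ v • e, ⟨N.sub_mem hv (N.smul_mem _ heN), ?_⟩, ψ v • e,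
    Submodule.smul_mem _ _ (Submodule.mem_span_singleton_self e), by simp⟩
  simp [LinearMap.mem_ker, he]

theorem finrank_sup_span [FiniteDimensional F V] (he : ψ e = 1) {W : Submodule F V}
    (hW : W ≤ LinearMap.ker ψ) : finrank F ↥(W ⊔ Submodule.span F {e}) = finrank F W + 1 := by
  have h0 : e ≠ 0 := fun h => by simp [h] at he
  have h := Submodule.finrank_sup_add_finrank_inf_eq W (Submodule.span F {e})
  have hbot : W ⊓ Submodule.span F {e} = ⊥ := by
    rw [eq_bot_iff]
    rintro v ⟨hv, hv'⟩
    obtain ⟨a, rfl⟩ := Submodule.mem_span_singleton.1 hv'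
    have : a = 0 := by simpa [he] using hW hv
    simp [this]
  rw [hbot, finrank_bot, finrank_span_singleton h0] at h
  simpa using h

theorem exists_mem_eq_one {N : Submodule F V} (hN : ¬ N ≤ LinearMap.ker ψ) :
    ∃ e ∈ N, ψ e = 1 := by
  obtain ⟨v, hv, hv'⟩ := Set.not_subset.1 hN
  have : ψ v ≠ 0 := hv'
  exact ⟨(ψ v)⁻¹ • v, N.smul_mem _ hv, by simp [this]⟩

theorem finrank_inf_ker [FiniteDimensional F V] {N : Submodule F V}
    (hN : ¬ N ≤ LinearMap.ker ψ) : finrank F ↥(N ⊓ LinearMap.ker ψ) + 1 = finrank F N := by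
  obtain ⟨e, heN, he⟩ := exists_mem_eq_one hN
  rw [← finrank_sup_span he inf_le_right, inf_ker_sup_span he heN]

theorem finrank_inf_ker_of_mem [FiniteDimensional F V] {N : Submodule F V} (he : ψ e = 1)
    (heN : e ∈ N) : finrank F ↥(N ⊓ LinearMap.ker ψ) + 1 = finrank F N :=
  finrank_inf_ker fun h => by simp [LinearMap.mem_ker.1 (h heN)] at he

theorem sup_span_inf_ker (he : ψ e = 1) {W : Submodule F V} (hW : W ≤ LinearMap.ker ψ) :
    (W ⊔ Submodule.span F {e}) ⊓ LinearMap.ker ψ = W := by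
  refine le_antisymm ?_ (le_inf le_sup_left hW)
  rintro v ⟨hv, hv'⟩
  obtain ⟨w, hw, s, hs, rfl⟩ := Submodule.mem_sup.1 hv
  obtain ⟨a, rfl⟩ := Submodule.mem_span_singleton.1 hs
  have hw' : ψ w = 0 := hW hw
  have : a = 0 := by simpa [he, hw'] using hv'
  simpa [this] using hw

theorem not_sup_span_le (he : ψ e = 1) (W : Submodule F V) :
    ¬ W ⊔ Submodule.span F {e} ≤ LinearMap.ker ψ := fun h => by
  have : ψ e = 0 := h (Submodule.mem_sup_right (Submodule.mem_span_singleton_self e))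
  simp [this] at he

theorem IsFlag.ins [FiniteDimensional F V] {K : Submodule F V} (heK : e ∈ K) (he : ψ e = 1)
    {W : ℕ → Submodule F V} (hW : IsFlag (K ⊓ LinearMap.ker ψ) W) {i : ℕ}
    (hi : i < finrank F K) : IsFlag K (ins (Submodule.span F {e}) i W) := by
  have hr := finrank_inf_ker_of_mem he heK
  refine ⟨?_, ?_, ?_⟩
  · intro j k hjk
    simp only [Steinberg.ins]
    split_ifs with h1 h2 h2
    · exact hW.mono hjk
    · exact (hW.mono (by omega)).trans le_sup_left
    · omega
    · exact sup_le_sup_right (hW.mono (by omega)) _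
  · intro j
    simp only [Steinberg.ins]
    split_ifs with h1
    · exact (hW.le j).trans inf_le_left
    · exact sup_le ((hW.le _).trans inf_le_left) ((Submodule.span_singleton_le_iff_mem _ _).2 heK)
  · intro j
    rcases le_or_gt j i with h1 | h1
    · rw [ins_of_le _ h1, hW.rank]; omega
    · rw [ins_of_lt _ h1, finrank_sup_span he ((hW.le _).trans inf_le_right), hW.rank]; omega

/-- The insertions at `k - 1` and `k` differ only in the `k`-th term, so their `k`-th faces agree
and cancel by sign. Every other insertion has a `k`-th face that factors through a face of `x`: the
one at `k - 1` if `i < k - 1`, the one at `k` if `i > k`. -/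
theorem mapDomain_erase_susp {ℓ : Submodule F V} {m k : ℕ} (hk : 0 < k) (hkm : k < m)
    {x : (ℕ → Submodule F V) →₀ ℤ}
    (hx : ∀ i, 0 < i → i + 1 < m → Finsupp.mapDomain (erase i) x = 0) :
    Finsupp.mapDomain (erase k) (susp ℓ m x) = 0 := by
  have hvanish : ∀ i ∈ Finset.range m, i ≠ k → i ≠ k - 1 →
      Finsupp.mapDomain (erase k ∘ ins ℓ i) x = 0 := by
    intro i hi h1 h2
    rw [Finset.mem_range] at hi
    have key : ∃ q, 0 < q ∧ q + 1 < m ∧ (erase k ∘ ins ℓ i) = (erase k ∘ ins ℓ i) ∘ erase q := by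
      rcases lt_or_gt_of_ne h1 with h | h
      · refine ⟨k - 1, by omega, by omega, ?_⟩
        ext W j : 2
        simp only [Function.comp_apply, erase, ins, Function.update_apply]
        split_ifs <;> first | rfl | omega
      · refine ⟨k, by omega, by omega, ?_⟩
        ext W j : 2
        simp only [Function.comp_apply, erase, ins, Function.update_apply]
        split_ifs <;> first | rfl | omega
    obtain ⟨q, hq, hq', h⟩ := key
    rw [h, Finsupp.mapDomain_comp, hx q hq hq', Finsupp.mapDomain_zero]
  have hcancel : (erase k ∘ ins ℓ k : (ℕ → Submodule F V) → _) = erase k ∘ ins ℓ (k - 1) := by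
    ext W j : 2
    simp only [Function.comp_apply, erase, ins, Function.update_apply]
    split_ifs <;> first | rfl | omega
  have hsum : Finsupp.mapDomain (erase k) (susp ℓ m x) =
      ∑ i ∈ Finset.range m, ((-1 : ℤ) ^ i) • Finsupp.mapDomain (erase k ∘ ins ℓ i) x := by
    rw [susp_apply, ← Finsupp.lmapDomain_apply ℤ ℤ, map_sum]
    refine Finset.sum_congr rfl fun i _ => ?_
    rw [map_smul, Finsupp.lmapDomain_apply, Finsupp.mapDomain_comp]
  rw [hsum, ← Finset.sum_subset (s₁ := {k - 1, k})]
  · rw [Finset.sum_pair (by omega), hcancel, ← add_smul]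
    obtain ⟨k, rfl⟩ : ∃ q, k = q + 1 := ⟨k - 1, by omega⟩
    simp [pow_succ]
  · intro i
    simp only [Finset.mem_insert, Finset.mem_singleton, Finset.mem_range]
    omega
  · intro i hi h
    simp only [Finset.mem_insert, Finset.mem_singleton, not_or] at h
    rw [hvanish i hi h.2 h.1, smul_zero]

theorem susp_mem [FiniteDimensional F V] {K : Submodule F V} (heK : e ∈ K) (he : ψ e = 1)
    {x : (ℕ → Submodule F V) →₀ ℤ} (hx : x ∈ flagCycles (K ⊓ LinearMap.ker ψ)) :
    susp (Submodule.span F {e}) (finrank F K) x ∈ flagCycles K := by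
  classical
  have hr := finrank_inf_ker_of_mem he heK
  have hx' := mem_flagCycles.1 hx
  refine mem_flagCycles.2 ⟨?_, fun k hk hkm => mapDomain_erase_susp hk hkm fun i hi him =>
    hx'.2 i hi (by omega)⟩
  suffices h : susp (Submodule.span F {e}) (finrank F K) x ∈
      Finsupp.supported ℤ ℤ {W | IsFlag K W} from fun W hW => (Finsupp.mem_supported _ _).1 h hW
  rw [susp_apply]
  refine Submodule.sum_mem _ fun i hi => Submodule.smul_mem _ _ ?_
  rw [Finsupp.mem_supported]
  intro W hW
  obtain ⟨W, hW', rfl⟩ := Finset.mem_image.1 (Finsupp.mapDomain_support hW)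
  exact (hx'.1 W hW').ins heK he (Finset.mem_range.1 hi)

end Hyperplane

end Flags

/-! ### Suspensions span the Steinberg module -/

section Spanning

theorem erase_eq_erase_iff {i : ℕ} {W W' : ℕ → Submodule F V} :
    erase i W = erase i W' ↔ ∀ j, j ≠ i → W j = W' j := by
  refine ⟨fun h j hj => ?_, fun h => ?_⟩
  · have := congrFun h j
    simpa [erase, hj] using this
  · ext j : 1
    by_cases hj : j = i
    · simp [erase, hj]
    · simp [erase, hj, h j hj]

/-- A cycle vanishes if each flag in its support has a term with property `p` that is determined
by the other terms and by having this property. -/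
theorem eq_zero_of_unique_filling {K : Submodule F V} {z : (ℕ → Submodule F V) →₀ ℤ}
    (hz : z ∈ flagCycles K) (p : Submodule F V → Prop)
    (h : ∀ f ∈ z.support, ∃ i, 0 < i ∧ i < finrank F K ∧ p (f i) ∧
      ∀ f' ∈ z.support, (∀ j, j ≠ i → f' j = f j) → p (f' i) → f' i = f i) : z = 0 := by
  classical
  by_contra hne
  -- For `f` with the fewest terms satisfying `p`, no other flag of the support has the same `i`-th
  -- face: a competitor with `p` at `i` is `f` itself, and one without it has fewer such terms. So
  -- the coefficient of `f` survives in the `i`-th face.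
  obtain ⟨f, hf, hmin⟩ := Finset.exists_min_image z.support
    (fun f => ((Finset.range (finrank F K)).filter fun j => p (f j)).card)
    (Finsupp.support_nonempty_iff.2 hne)
  obtain ⟨i, hi, hi', hp, hu⟩ := h f hf
  have hfib : ∀ f' ∈ z.support, erase i f' = erase i f → f' = f := by
    intro f' hf' he
    rw [erase_eq_erase_iff] at he
    have hpi : p (f' i) := by
      by_contra hnp
      refine (hmin f' hf').not_gt (Finset.card_lt_card ⟨?_, fun hsub => ?_⟩)
      · intro j
        simp only [Finset.mem_filter]
        rintro ⟨hj, hpj⟩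
        have hji : j ≠ i := fun hji => hnp (hji ▸ hpj)
        exact ⟨hj, he j hji ▸ hpj⟩
      · have := hsub (Finset.mem_filter.2 ⟨Finset.mem_range.2 hi', hp⟩)
        exact hnp (Finset.mem_filter.1 this).2
    ext j : 1
    by_cases hj : j = i
    · rw [hj, hu f' hf' he hpi]
    · exact he j hj
  have h0 := DFunLike.congr_fun ((mem_flagCycles.1 hz).2 i hi hi') (erase i f)
  rw [Finsupp.mapDomain, Finsupp.sum_apply, Finsupp.sum, Finset.sum_eq_single f] at h0
  · exact Finsupp.mem_support_iff.1 hf (by simpa using h0)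
  · intro f' hf' hne'
    rw [Finsupp.single_apply, if_neg fun he => hne' (hfib f' hf' he)]
  · exact fun hf' => absurd hf hf'

/-- As `p` is constant on the fibres of `f`, the two parts of `z` push forward to chains with
disjoint supports, so they cannot cancel each other. -/
theorem mapDomain_filter_eq_zero {α β : Type*} {f : α → β} {z : α →₀ ℤ}
    (hz : Finsupp.mapDomain f z = 0) (p : α → Prop) [DecidablePred p]
    (hp : ∀ a b, f a = f b → (p a ↔ p b)) : Finsupp.mapDomain f (z.filter p) = 0 := by
  classical
  ext b
  by_cases hb : ∃ a, f a = b ∧ p a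
  · obtain ⟨a, rfl, ha⟩ := hb
    have h0 := DFunLike.congr_fun hz (f a)
    have hsplit : Finsupp.mapDomain f z = Finsupp.mapDomain f (z.filter p) +
        Finsupp.mapDomain f (z.filter fun a => ¬ p a) := by
      rw [← Finsupp.mapDomain_add, Finsupp.filter_add_filter_not]
    have hzero : Finsupp.mapDomain f (z.filter fun a => ¬ p a) (f a) = 0 := by
      refine Finsupp.notMem_support_iff.1 fun hmem => ?_
      obtain ⟨a', ha', he⟩ := Finset.mem_image.1 (Finsupp.mapDomain_support hmem)
      rw [Finsupp.support_filter, Finset.mem_filter] at ha'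
      exact ha'.2 ((hp _ _ he).2 ha)
    rw [hsplit, Finsupp.add_apply, hzero, add_zero] at h0
    exact h0
  · refine Finsupp.notMem_support_iff.1 fun hmem => ?_
    obtain ⟨a', ha', he⟩ := Finset.mem_image.1 (Finsupp.mapDomain_support hmem)
    rw [Finsupp.support_filter, Finset.mem_filter] at ha'
    exact hb ⟨a', he, ha'.2⟩

theorem mapDomain_apply_eq_zero {α β : Type*} {f : α → β} {z : α →₀ ℤ} {b : β}
    (h : ∀ a ∈ z.support, f a ≠ b) : Finsupp.mapDomain f z b = 0 := by
  classical
  refine Finsupp.notMem_support_iff.1 fun hmem => ?_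
  obtain ⟨a, ha, he⟩ := Finset.mem_image.1 (Finsupp.mapDomain_support hmem)
  exact h a ha he

variable [FiniteDimensional F V] {K : Submodule F V}

/-- At the last index `i` with `f i ≤ ker ψ`, the term is forced: `f i = f (i + 1) ∩ ker ψ` by
dimension. The hypothesis on `f 1` ensures `i > 0`. -/
theorem eq_zero_of_forall_one_le {ψ : Dual F V} (hK : ¬ K ≤ LinearMap.ker ψ)
    {z : (ℕ → Submodule F V) →₀ ℤ} (hz : z ∈ flagCycles K)
    (h : ∀ f ∈ z.support, f 1 ≤ LinearMap.ker ψ) : z = 0 := by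
  classical
  refine eq_zero_of_unique_filling hz (· ≤ LinearMap.ker ψ) fun f hf => ?_
  have hflag := (mem_flagCycles.1 hz).1
  have hex : ∃ j, ¬ f j ≤ LinearMap.ker ψ :=
    ⟨finrank F K, by rwa [(hflag f hf).top le_rfl]⟩
  have h2 : 2 ≤ Nat.find hex := by
    rw [Nat.le_find_iff]
    intro j hj
    rw [not_not]
    exact ((hflag f hf).mono (by omega)).trans (h f hf)
  have hle : Nat.find hex ≤ finrank F K := Nat.find_min' hex (by rwa [(hflag f hf).top le_rfl])
  obtain ⟨i, hi⟩ : ∃ i, Nat.find hex = i + 1 := ⟨Nat.find hex - 1, by omega⟩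
  have hspec := Nat.find_spec hex
  rw [hi] at hspec
  refine ⟨i, by omega, by omega, not_not.1 (Nat.find_min hex (m := i) (by omega)), ?_⟩
  intro f' hf' he hp
  have hr := finrank_inf_ker hspec
  rw [(hflag f hf).rank] at hr
  have key : ∀ g ∈ z.support, g (i + 1) = f (i + 1) → g i ≤ LinearMap.ker ψ →
      g i = f (i + 1) ⊓ LinearMap.ker ψ := by
    intro g hg hgi hgp
    refine Submodule.eq_of_le_of_finrank_eq
      (le_inf (hgi ▸ (hflag g hg).mono (Nat.le_succ i)) hgp) ?_
    rw [(hflag g hg).rank]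
    omega
  rw [key f' hf' (he _ (by omega)) hp,
    key f hf rfl (not_not.1 (Nat.find_min hex (m := i) (by omega)))]

/-- Dual argument: the first term containing `e` is forced to be the preceding term plus the line of
`e`. The hypothesis keeps its index below the dimension of `K`. -/
theorem eq_zero_of_forall_mem {e : V} (he : e ≠ 0)
    {z : (ℕ → Submodule F V) →₀ ℤ} (hz : z ∈ flagCycles K)
    (h : ∀ f ∈ z.support, e ∈ f (finrank F K - 1)) : z = 0 := by
  classical
  refine eq_zero_of_unique_filling hz (e ∈ ·) fun f hf => ?_
  have hflag := (mem_flagCycles.1 hz).1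
  have hex : ∃ j, e ∈ f j := ⟨_, h f hf⟩
  have hpos : 0 < Nat.find hex := by
    rw [Nat.find_pos, (hflag f hf).zero]
    simpa using he
  have hle : Nat.find hex ≤ finrank F K - 1 := Nat.find_min' hex (h f hf)
  obtain ⟨i, hi⟩ : ∃ i, Nat.find hex = i + 1 := ⟨Nat.find hex - 1, by omega⟩
  have hspec := Nat.find_spec hex
  rw [hi] at hspec
  have hnot : e ∉ f i := Nat.find_min hex (by omega)
  refine ⟨i + 1, by omega, by omega, hspec, ?_⟩
  intro f' hf' hff' hp
  obtain ⟨ψ, hψ, hψ'⟩ := Submodule.exists_dual_map_eq_bot_of_notMem hnot inferInstance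
  have hker : f i ≤ LinearMap.ker ((ψ e)⁻¹ • ψ) := by
    intro v hv
    have : ψ v ∈ (f i).map ψ := Submodule.mem_map_of_mem hv
    rw [hψ', Submodule.mem_bot] at this
    simp [this]
  have hr := finrank_sup_span (ψ := (ψ e)⁻¹ • ψ) (e := e) (by simp [hψ]) hker
  rw [(hflag f hf).rank] at hr
  have key : ∀ g ∈ z.support, g i = f i → e ∈ g (i + 1) →
      f i ⊔ Submodule.span F {e} = g (i + 1) := by
    intro g hg hgi hge
    refine Submodule.eq_of_le_of_finrank_eq (sup_le (hgi ▸ (hflag g hg).mono (Nat.le_succ i))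
      ((Submodule.span_singleton_le_iff_mem _ _).2 hge)) ?_
    rw [(hflag g hg).rank]
    omega
  rw [← key f' hf' (hff' _ (by omega)) hp, key f hf rfl hspec]

/-- The Steinberg module of `K` is spanned by the suspensions of the Steinberg module of a fixed
hyperplane of `K`. -/
theorem flagCycles_le_iSup_vector {ψ : Dual F V} (hK : ¬ K ≤ LinearMap.ker ψ) :
    flagCycles K ≤ ⨆ e : {e : V // e ∈ K ∧ ψ e = 1},
      (flagCycles (K ⊓ LinearMap.ker ψ)).map (susp (Submodule.span F {e.1}) (finrank F K)) := by
  classical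
  intro z hz
  have hr := finrank_inf_ker hK
  have hz' := mem_flagCycles.1 hz
  have hflag := hz'.1
  -- Flags with a given first line `ℓ` outside `ker ψ` correspond to flags of the hyperplane by
  -- intersecting with `ker ψ` and shifting the index; `ins ℓ 0` is the inverse.
  set q : (ℕ → Submodule F V) → ℕ → Submodule F V :=
    fun W j => W (j + 1) ⊓ LinearMap.ker ψ with hq
  set T := (z.support.filter fun f => ¬ f 1 ≤ LinearMap.ker ψ).image fun f => f 1 with hT
  set part : Submodule F V → (ℕ → Submodule F V) →₀ ℤ := fun ℓ => z.filter fun f => f 1 = ℓ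
    with hpart
  have hpart_supp : ∀ ℓ, ∀ f ∈ (part ℓ).support, f ∈ z.support ∧ f 1 = ℓ := by
    intro ℓ f hf
    rwa [hpart, Finsupp.support_filter, Finset.mem_filter] at hf
  have hline : ∀ ℓ ∈ T, ∃ e, e ∈ K ∧ ψ e = 1 ∧ Submodule.span F {e} = ℓ := by
    intro ℓ hℓ
    obtain ⟨f, hf, rfl⟩ := Finset.mem_image.1 hℓ
    obtain ⟨hf, hf1⟩ := Finset.mem_filter.1 hf
    obtain ⟨e, he, he1⟩ := exists_mem_eq_one hf1
    refine ⟨e, (hflag f hf).le 1 he, he1, Submodule.eq_of_le_of_finrank_eq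
      ((Submodule.span_singleton_le_iff_mem _ _).2 he) ?_⟩
    rw [finrank_span_singleton (fun h => by simp [h] at he1), (hflag f hf).rank]
    omega
  have hmem : ∀ ℓ ∈ T, Finsupp.mapDomain q (part ℓ) ∈ flagCycles (K ⊓ LinearMap.ker ψ) := by
    intro ℓ hℓ
    obtain ⟨e, heK, he, rfl⟩ := hline ℓ hℓ
    refine mem_flagCycles.2 ⟨fun W hW => ?_, fun i hi hi' => ?_⟩
    · obtain ⟨f, hf, rfl⟩ := Finset.mem_image.1 (Finsupp.mapDomain_support hW)
      obtain ⟨hf, hf1⟩ := hpart_supp _ f hf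
      refine ⟨fun j k hjk => inf_le_inf_right _ ((hflag f hf).mono (by omega)),
        fun j => inf_le_inf_right _ ((hflag f hf).le _), fun j => ?_⟩
      have hnot : ¬ f (j + 1) ≤ LinearMap.ker ψ := fun h => by
        have := h ((hflag f hf).mono (show 1 ≤ j + 1 by omega)
          (hf1 ▸ Submodule.mem_span_singleton_self e))
        simp [LinearMap.mem_ker.1 this] at he
      have := finrank_inf_ker hnot
      rw [(hflag f hf).rank] at this
      change finrank F ↥(f (j + 1) ⊓ LinearMap.ker ψ) = _
      omega
    · have hcomm : erase i ∘ q = q ∘ erase (i + 1) := by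
        ext W j : 2
        by_cases hj : j = i <;> simp [erase, hq, hj]
      rw [← Finsupp.mapDomain_comp, hcomm, Finsupp.mapDomain_comp,
        mapDomain_filter_eq_zero (hz'.2 (i + 1) (by omega) (by omega)), Finsupp.mapDomain_zero]
      intro a b hab
      rw [erase_eq_erase_iff.1 hab 1 (by omega)]
  -- Only the insertion at `0` produces flags whose first line is outside `ker ψ`. So the
  -- suspensions reproduce the coefficients of `z` at these flags, and the difference is a cycle to
  -- which `eq_zero_of_forall_one_le` applies.
  have hval : ∀ ℓ ∈ T, ∀ f, ¬ f 1 ≤ LinearMap.ker ψ →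
      susp ℓ (finrank F K) (Finsupp.mapDomain q (part ℓ)) f = if f 1 = ℓ then z f else 0 := by
    intro ℓ hℓ f hf
    obtain ⟨e, heK, he, rfl⟩ := hline ℓ hℓ
    rw [susp_apply, Finsupp.finsetSum_apply, Finset.sum_eq_single 0]
    · rw [← Finsupp.mapDomain_comp, Finsupp.mapDomain_congr (g := id), Finsupp.mapDomain_id]
      · simp [hpart, Finsupp.filter_apply]
      · intro f hf
        obtain ⟨hf, hf1⟩ := hpart_supp _ f hf
        ext j : 1
        rcases Nat.eq_zero_or_pos j with rfl | hj
        · simp only [Function.comp_apply, ins_of_le _ le_rfl, hq, id, (hflag f hf).zero, zero_add,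
            hf1]
          have := sup_span_inf_ker (ψ := ψ) (e := e) he (W := ⊥) bot_le
          rwa [bot_sup_eq] at this
        · simp only [Function.comp_apply, ins_of_lt _ hj, hq, id, Nat.sub_add_cancel hj]
          exact inf_ker_sup_span he ((hflag f hf).mono (show 1 ≤ j from hj)
            (hf1 ▸ Submodule.mem_span_singleton_self e))
    · intro i _ hi
      rw [Finsupp.smul_apply, ← Finsupp.mapDomain_comp, mapDomain_apply_eq_zero, smul_zero]
      rintro g _ rfl
      refine hf ?_
      rw [Function.comp_apply, ins_of_le _ (by omega)]
      exact inf_le_right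
    · intro h
      exact absurd (Finset.mem_range.2 (by omega)) h
  have hsusp : ∀ ℓ ∈ T, susp ℓ (finrank F K) (Finsupp.mapDomain q (part ℓ)) ∈ flagCycles K := by
    intro ℓ hℓ
    have := hmem ℓ hℓ
    obtain ⟨e, heK, he, rfl⟩ := hline ℓ hℓ
    exact susp_mem heK he this
  have hzero : z - ∑ ℓ ∈ T, susp ℓ (finrank F K) (Finsupp.mapDomain q (part ℓ)) = 0 := by
    refine eq_zero_of_forall_one_le hK (Submodule.sub_mem _ hz (Submodule.sum_mem _ hsusp)) ?_
    intro f hf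
    by_contra hf1
    refine Finsupp.mem_support_iff.1 hf ?_
    rw [Finsupp.sub_apply, Finsupp.finsetSum_apply,
      Finset.sum_congr rfl fun ℓ hℓ => hval ℓ hℓ f hf1, Finset.sum_ite_eq]
    split_ifs with h
    · exact sub_self _
    · rw [sub_zero]
      by_contra hzf
      exact h (Finset.mem_image_of_mem _
        (Finset.mem_filter.2 ⟨Finsupp.mem_support_iff.2 hzf, hf1⟩))
  rw [sub_eq_zero.1 hzero]
  refine Submodule.sum_mem _ fun ℓ hℓ => ?_
  have := hmem ℓ hℓ
  obtain ⟨e, heK, he, rfl⟩ := hline ℓ hℓ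
  exact Submodule.mem_iSup_of_mem ⟨e, heK, he⟩ (Submodule.mem_map_of_mem this)

/-- The Steinberg module of `K` is spanned by the suspensions, by a fixed line, of the Steinberg
modules of its complements in `K`. -/
theorem flagCycles_le_iSup_dual {e : V} (heK : e ∈ K) (he0 : e ≠ 0) :
    flagCycles K ≤ ⨆ ψ : {ψ : Dual F V // ψ e = 1},
      (flagCycles (K ⊓ LinearMap.ker ψ.1)).map (susp (Submodule.span F {e}) (finrank F K)) := by
  classical
  intro z hz
  set ℓ := Submodule.span F {e} with hℓ
  have hK : 0 < finrank F K := by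
    rw [Nat.pos_iff_ne_zero, Ne, Submodule.finrank_eq_zero]
    rintro rfl
    exact he0 ((Submodule.mem_bot F).1 heK)
  obtain ⟨m, hm⟩ : ∃ m, finrank F K = m + 1 := ⟨finrank F K - 1, by omega⟩
  have hz' := mem_flagCycles.1 hz
  have hflag := hz'.1
  -- A flag of `K` with a given hyperplane term `H` not containing `e` is truncated to a flag of
  -- `H`; inserting the line at `m` recovers it.
  set q : (ℕ → Submodule F V) → ℕ → Submodule F V := fun W j => W (min j m) with hq
  set T := (z.support.filter fun f => e ∉ f m).image fun f => f m with hT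
  set part : Submodule F V → (ℕ → Submodule F V) →₀ ℤ := fun H => z.filter fun f => f m = H
    with hpart
  have hpart_supp : ∀ H, ∀ f ∈ (part H).support, f ∈ z.support ∧ f m = H := by
    intro H f hf
    rwa [hpart, Finsupp.support_filter, Finset.mem_filter] at hf
  have hcompl : ∀ H ∈ T, ∃ ψ : Dual F V, ψ e = 1 ∧ K ⊓ LinearMap.ker ψ = H := by
    intro H hH
    obtain ⟨f, hf, rfl⟩ := Finset.mem_image.1 hH
    obtain ⟨hf, hf1⟩ := Finset.mem_filter.1 hf
    obtain ⟨ψ, hψ, hψ'⟩ := Submodule.exists_dual_map_eq_bot_of_notMem hf1 inferInstance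
    have he : ((ψ e)⁻¹ • ψ) e = 1 := by simp [hψ]
    refine ⟨(ψ e)⁻¹ • ψ, he, (Submodule.eq_of_le_of_finrank_eq
      (le_inf ((hflag f hf).le _) fun v hv => ?_) ?_).symm⟩
    · have : ψ v ∈ (f m).map ψ := Submodule.mem_map_of_mem hv
      rw [hψ', Submodule.mem_bot] at this
      simp [this]
    · have := finrank_inf_ker_of_mem he heK
      rw [(hflag f hf).rank]
      omega
  have hmem : ∀ H ∈ T, Finsupp.mapDomain q (part H) ∈ flagCycles H := by
    intro H hH
    have hrH : finrank F H = m := by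
      obtain ⟨ψ, he, rfl⟩ := hcompl H hH
      have := finrank_inf_ker_of_mem he heK
      omega
    refine mem_flagCycles.2 ⟨fun W hW => ?_, fun i hi hi' => ?_⟩
    · obtain ⟨f, hf, rfl⟩ := Finset.mem_image.1 (Finsupp.mapDomain_support hW)
      obtain ⟨hf, hf1⟩ := hpart_supp _ f hf
      refine ⟨fun j k hjk => (hflag f hf).mono (by omega),
        fun j => hf1 ▸ (hflag f hf).mono (by omega), fun j => ?_⟩
      change finrank F ↥(f (min j m)) = _
      rw [(hflag f hf).rank]
      omega
    · have hcomm : erase i ∘ q = q ∘ erase i := by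
        ext W j : 2
        simp only [Function.comp_apply, erase, hq, Function.update_apply]
        split_ifs <;> first | rfl | omega
      rw [← Finsupp.mapDomain_comp, hcomm, Finsupp.mapDomain_comp,
        mapDomain_filter_eq_zero (hz'.2 i (by omega) (by omega)), Finsupp.mapDomain_zero]
      intro a b hab
      rw [erase_eq_erase_iff.1 hab m (by omega)]
  -- Every insertion before `m` puts `e` into the `m`-th term, so only the last one contributes
  -- here, with sign `(-1) ^ m`.
  have hval : ∀ H ∈ T, ∀ f, e ∉ f m →
      susp ℓ (finrank F K) (Finsupp.mapDomain q (part H)) f =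
        (-1) ^ m * if f m = H then z f else 0 := by
    intro H hH f hf
    rw [susp_apply, Finsupp.finsetSum_apply, Finset.sum_eq_single m]
    · rw [← Finsupp.mapDomain_comp, Finsupp.mapDomain_congr (g := id), Finsupp.mapDomain_id]
      · simp [hpart, Finsupp.filter_apply]
      · intro f hf
        obtain ⟨hf, hf1⟩ := hpart_supp _ f hf
        obtain ⟨ψ, he, hψ⟩ := hcompl H hH
        ext j : 1
        rcases le_or_gt j m with hj | hj
        · simp [ins_of_le _ hj, hq, hj]
        · simp only [Function.comp_apply, ins_of_lt _ hj, hq, id, (hflag f hf).top (hm.trans_le hj)]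
          rw [min_eq_right (by omega), hf1, ← hψ]
          exact inf_ker_sup_span he heK
    · intro i hi hne
      rw [Finset.mem_range] at hi
      rw [Finsupp.smul_apply, ← Finsupp.mapDomain_comp, mapDomain_apply_eq_zero, smul_zero]
      rintro g _ rfl
      refine hf ?_
      rw [Function.comp_apply, ins_of_lt _ (by omega)]
      exact Submodule.mem_sup_right (Submodule.mem_span_singleton_self e)
    · intro h
      exact absurd (Finset.mem_range.2 (by omega)) h
  have hsusp : ∀ H ∈ T, susp ℓ (finrank F K) (Finsupp.mapDomain q (part H)) ∈ flagCycles K := by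
    intro H hH
    have := hmem H hH
    obtain ⟨ψ, he, rfl⟩ := hcompl H hH
    exact susp_mem heK he this
  have hzero : z - ∑ H ∈ T,
      ((-1 : ℤ) ^ m) • susp ℓ (finrank F K) (Finsupp.mapDomain q (part H)) = 0 := by
    refine eq_zero_of_forall_mem he0 (Submodule.sub_mem _ hz
      (Submodule.sum_mem _ fun H hH => Submodule.smul_mem _ _ (hsusp H hH))) ?_
    intro f hf
    by_contra hf1
    rw [hm, Nat.add_sub_cancel] at hf1
    refine Finsupp.mem_support_iff.1 hf ?_
    have hterm : ∀ H ∈ T,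
        (((-1 : ℤ) ^ m) • susp ℓ (finrank F K) (Finsupp.mapDomain q (part H))) f =
          if f m = H then z f else 0 := by
      intro H hH
      rw [Finsupp.smul_apply, hval H hH f hf1, smul_eq_mul, ← mul_assoc, ← mul_pow]
      simp
    rw [Finsupp.sub_apply, Finsupp.finsetSum_apply, Finset.sum_congr rfl hterm, Finset.sum_ite_eq]
    split_ifs with h
    · exact sub_self _
    · rw [sub_zero]
      by_contra hzf
      exact h (Finset.mem_image_of_mem _
        (Finset.mem_filter.2 ⟨Finsupp.mem_support_iff.2 hzf, hf1⟩))
  rw [sub_eq_zero.1 hzero]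
  refine Submodule.sum_mem _ fun H hH => Submodule.smul_mem _ _ ?_
  have := hmem H hH
  obtain ⟨ψ, he, rfl⟩ := hcompl H hH
  exact Submodule.mem_iSup_of_mem ⟨ψ, he⟩ (Submodule.mem_map_of_mem this)

end Spanning

/-! ### Pairings with weights on the flags -/

section WeightedPairing

variable {A : Type*} [AddCommGroup A]

/-- The pairing `∑ x_W y_W w(W)` of chains with weights `w`. -/
def weightedPairing {α : Type*} (w : α → A) : (α →₀ ℤ) →ₗ[ℤ] (α →₀ ℤ) →ₗ[ℤ] A :=
  Finsupp.linearCombination ℤ fun a => (Finsupp.lapply a : (α →₀ ℤ) →ₗ[ℤ] ℤ).smulRight (w a)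

theorem weightedPairing_apply {α : Type*} (w : α → A) (x y : α →₀ ℤ) :
    weightedPairing w x y = ∑ a ∈ x.support, x a • y a • w a := by
  simp [weightedPairing, Finsupp.linearCombination_apply, Finsupp.sum, LinearMap.sum_apply]

theorem weightedPairing_single_single {α : Type*} [DecidableEq α] (w : α → A) (a b : α) :
    weightedPairing w (Finsupp.single a 1) (Finsupp.single b 1) = if a = b then w a else 0 := by
  simp [weightedPairing, Finsupp.single_apply, eq_comm]

theorem weightedPairing_congr {α : Type*} {w w' : α → A} {x : α →₀ ℤ}
    (h : ∀ a ∈ x.support, w a = w' a) (y : α →₀ ℤ) :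
    weightedPairing w x y = weightedPairing w' x y := by
  rw [weightedPairing_apply, weightedPairing_apply]
  exact Finset.sum_congr rfl fun a ha => by rw [h a ha]

theorem linearMap_ext_on_support {α : Type*} {s : Set α} {f g : (α →₀ ℤ) →ₗ[ℤ] A}
    (h : ∀ a ∈ s, f (Finsupp.single a 1) = g (Finsupp.single a 1)) {x : α →₀ ℤ}
    (hx : ∀ a ∈ x.support, a ∈ s) : f x = g x := by
  have hsum : x = ∑ a ∈ x.support, x a • Finsupp.single a 1 := by
    conv_lhs => rw [← x.sum_single]
    exact Finset.sum_congr rfl fun a _ => by simp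
  rw [hsum, map_sum, map_sum]
  exact Finset.sum_congr rfl fun a ha => by rw [map_smul, map_smul, h a (hx a ha)]

theorem bilinearMap_ext_on_support {α : Type*} {s : Set α}
    {f g : (α →₀ ℤ) →ₗ[ℤ] (α →₀ ℤ) →ₗ[ℤ] A}
    (h : ∀ a ∈ s, ∀ b ∈ s, f (Finsupp.single a 1) (Finsupp.single b 1) =
      g (Finsupp.single a 1) (Finsupp.single b 1)) {x y : α →₀ ℤ}
    (hx : ∀ a ∈ x.support, a ∈ s) (hy : ∀ a ∈ y.support, a ∈ s) : f x y = g x y :=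
  linearMap_ext_on_support (f := f.flip y) (g := g.flip y)
    (fun a ha => linearMap_ext_on_support (h a ha) hy) hx

theorem weightedPairing_act {K : Submodule F V} {g : V →ₗ[F] V}
    (hg : ∀ v ∈ K, g v = 0 → v = 0) (w : (ℕ → Submodule F V) → A)
    {x y : (ℕ → Submodule F V) →₀ ℤ} (hx : x ∈ flagCycles K) (hy : y ∈ flagCycles K) :
    weightedPairing w (act g x) (act g y) =
      weightedPairing (fun W => w fun j => (W j).map g) x y := by
  classical
  refine bilinearMap_ext_on_support (s := {W | IsFlag K W})
    (f := (weightedPairing w).compl₁₂ (act g) (act g)) (fun W hW W' hW' => ?_)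
    (mem_flagCycles.1 hx).1 (mem_flagCycles.1 hy).1
  rw [LinearMap.compl₁₂_apply, act_single, act_single, weightedPairing_single_single,
    weightedPairing_single_single]
  refine if_congr ⟨fun h => funext fun j => ?_, fun h => h ▸ rfl⟩ rfl rfl
  exact map_injective_of_injOn hg (hW.le j) (hW'.le j) (congrFun h j)

end WeightedPairing

/-- The map `v ↦ v + φ(v) e`. -/
def shear (φ : Dual F V) (e : V) : V →ₗ[F] V := LinearMap.id + φ.smulRight e

theorem shear_apply (φ : Dual F V) (e v : V) : shear φ e v = v + φ v • e := rfl

/-! ### Shears, and the pairing of a suspension with a sheared suspension -/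

section Shear

variable {ψ φ : Dual F V} {e : V}

theorem map_shear_sup_span (W : Submodule F V) :
    W.map (shear φ e) ⊔ Submodule.span F {e} = W ⊔ Submodule.span F {e} := by
  have he : ∀ (N : Submodule F V) (a : F), a • e ∈ N ⊔ Submodule.span F {e} := fun N a =>
    Submodule.mem_sup_right (Submodule.smul_mem _ _ (Submodule.mem_span_singleton_self e))
  refine le_antisymm (sup_le ?_ le_sup_right) (sup_le ?_ le_sup_right)
  · rintro _ ⟨v, hv, rfl⟩
    exact Submodule.add_mem _ (Submodule.mem_sup_left hv) (he _ _)
  · intro v hv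
    have : v = shear φ e v - φ v • e := by simp [shear_apply]
    rw [this]
    exact Submodule.sub_mem _ (Submodule.mem_sup_left (Submodule.mem_map_of_mem hv)) (he _ _)

theorem map_shear_eq_self {W : Submodule F V} (hW : W ≤ LinearMap.ker φ) :
    W.map (shear φ e) = W := by
  rw [map_congr_of_le (h := LinearMap.id) (K := W) _ le_rfl, Submodule.map_id]
  intro v hv
  simp [shear_apply, LinearMap.mem_ker.1 (hW hv)]

theorem notMem_map_shear (he : ψ e = 1) (hφ : φ e = 0) {W : Submodule F V}
    (hW : W ≤ LinearMap.ker ψ) : e ∉ W.map (shear φ e) := by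
  rintro ⟨v, hv, hve⟩
  have h1 : ψ v = 0 := hW hv
  have h2 := congrArg ψ hve
  have h3 := congrArg φ hve
  simp [shear_apply, he, h1, hφ] at h2 h3
  rw [h3] at h2
  exact zero_ne_one h2

/-- The first term containing `e` locates the insertion, so `i = j`. Adding the line of `e` undoes
the shear, and intersecting with `ker ψ` then recovers `W = W'`. Finally `W i` equals its own
sheared image, and for `v ∈ W i` the value of `ψ` on `v + φ(v) e` is `φ v`, which must vanish. -/
theorem ins_eq_ins_shear_iff (he : ψ e = 1) (hφ : φ e = 0) {W W' : ℕ → Submodule F V}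
    (hWm : Monotone W) (hW : ∀ j, W j ≤ LinearMap.ker ψ) (hW' : ∀ j, W' j ≤ LinearMap.ker ψ)
    {i j : ℕ} :
    ins (Submodule.span F {e}) i W =
      ins (Submodule.span F {e}) j (fun k => (W' k).map (shear φ e)) ↔
      i = j ∧ W = W' ∧ W i ≤ LinearMap.ker φ := by
  have hspan : ∀ N : Submodule F V, e ∈ N ⊔ Submodule.span F {e} := fun N =>
    Submodule.mem_sup_right (Submodule.mem_span_singleton_self e)
  constructor
  · intro h
    have hij : i = j := by
      rcases lt_trichotomy i j with hlt | heq | hgt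
      · have := congrFun h j
        rw [ins_of_lt _ hlt, ins_of_le _ le_rfl] at this
        exact absurd (this ▸ hspan _) (notMem_map_shear he hφ (hW' j))
      · exact heq
      · have := congrFun h i
        rw [ins_of_lt _ hgt, ins_of_le _ le_rfl] at this
        have : ψ e = 0 := hW i (this ▸ hspan _)
        simp [this] at he
    subst hij
    have heq : W = W' := by
      have hsup : ∀ k, W k ⊔ Submodule.span F {e} = W' k ⊔ Submodule.span F {e} := by
        intro k
        rcases le_or_gt k i with hk | hk
        · have := congrFun h k
          rw [ins_of_le _ hk, ins_of_le _ hk] at this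
          rw [this, map_shear_sup_span]
        · have := congrFun h (k + 1)
          rw [ins_of_lt _ (by omega), ins_of_lt _ (by omega), map_shear_sup_span] at this
          exact this
      ext k : 1
      rw [← sup_span_inf_ker he (hW k), hsup, sup_span_inf_ker he (hW' k)]
    refine ⟨rfl, heq, fun v hv => ?_⟩
    have := congrFun h i
    rw [ins_of_le _ le_rfl, ins_of_le _ le_rfl, ← heq] at this
    have h1 : ψ (shear φ e v) = 0 := hW i (this ▸ Submodule.mem_map_of_mem hv)
    have h2 : ψ v = 0 := hW i hv
    simpa [shear_apply, h2, he] using h1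
  · rintro ⟨rfl, rfl, h⟩
    ext k : 1
    rcases le_or_gt k i with hk | hk
    · rw [ins_of_le _ hk, ins_of_le _ hk, map_shear_eq_self ((hWm hk).trans h)]
    · rw [ins_of_lt _ hk, ins_of_lt _ hk, map_shear_sup_span]

-- Matching insertions occur at the same index, so their signs multiply to `1`; the insertions at
-- `i` agree exactly when `W i ≤ ker φ`.
open Classical in
theorem weightedPairing_susp {A : Type*} [AddCommGroup A] (he : ψ e = 1) (hφ : φ e = 0)
    {H : Submodule F V} (hH : H ≤ LinearMap.ker ψ) (m : ℕ) (w : (ℕ → Submodule F V) → A)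
    {x y : (ℕ → Submodule F V) →₀ ℤ} (hx : x ∈ flagCycles H) (hy : y ∈ flagCycles H) :
    weightedPairing w (susp (Submodule.span F {e}) m x)
      (susp (Submodule.span F {e}) m (act (shear φ e) y)) =
    weightedPairing (fun W => ∑ i ∈ Finset.range m, if W i ≤ LinearMap.ker φ then
      w (ins (Submodule.span F {e}) i W) else 0) x y := by
  refine bilinearMap_ext_on_support (s := {W | IsFlag H W})
    (f := (weightedPairing w).compl₁₂ (susp (Submodule.span F {e}) m)
      (susp (Submodule.span F {e}) m ∘ₗ act (shear φ e))) (fun W hW W' hW' => ?_)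
    (mem_flagCycles.1 hx).1 (mem_flagCycles.1 hy).1
  rw [LinearMap.compl₁₂_apply, LinearMap.comp_apply, act_single, susp_single, susp_single,
    weightedPairing_single_single]
  simp only [map_sum, LinearMap.sum_apply, map_smul, LinearMap.smul_apply,
    weightedPairing_single_single, ins_eq_ins_shear_iff he hφ hW.mono
      (fun j => (hW.le j).trans hH) (fun j => (hW'.le j).trans hH)]
  split_ifs with h
  · refine Finset.sum_congr rfl fun i hi => ?_
    rw [Finset.sum_eq_single i]
    · simp [h, smul_smul, ← mul_pow]
    · intro j _ hj
      rw [if_neg fun hc => hj hc.1]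
      simp
    · exact fun hi' => absurd hi hi'
  · refine Finset.sum_eq_zero fun i _ => ?_
    simp [h]

end Shear

/-! ### Position of a flag relative to a hyperplane -/

section Position

open Classical in
/-- The position, up to `m`, of a flag relative to the kernel of `φ`: the last index at which the
flag is contained in it. -/
def pos (m : ℕ) (φ : Dual F V) (W : ℕ → Submodule F V) : ℕ :=
  Nat.findGreatest (fun j => W j ≤ LinearMap.ker φ) m

open Classical in
theorem pos_le (m : ℕ) (φ : Dual F V) (W : ℕ → Submodule F V) : pos m φ W ≤ m :=
  Nat.findGreatest_le m

open Classical in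
theorem IsFlag.le_ker_iff [FiniteDimensional F V] {K : Submodule F V} {W : ℕ → Submodule F V}
    (hW : IsFlag K W) (φ : Dual F V) {i m : ℕ} (hi : i ≤ m) :
    W i ≤ LinearMap.ker φ ↔ i ≤ pos m φ W := by
  have h0 : W 0 ≤ LinearMap.ker φ := by rw [hW.zero]; exact bot_le
  refine ⟨fun h => ?_, fun h => (hW.mono h).trans ?_⟩
  · unfold pos
    exact Nat.le_findGreatest hi h
  · unfold pos
    exact Nat.findGreatest_spec (P := fun j => W j ≤ LinearMap.ker φ) (Nat.zero_le m) h0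

open Classical in
theorem IsFlag.sum_pos [FiniteDimensional F V] {A : Type*} [AddCommGroup A] {K : Submodule F V}
    {W : ℕ → Submodule F V} (hW : IsFlag K W) (φ : Dual F V) (m : ℕ) (d : ℕ → A) :
    (∑ i ∈ Finset.range (m + 1), if W i ≤ LinearMap.ker φ then d i else 0) =
      ∑ i ∈ Finset.range (pos m φ W + 1), d i := by
  rw [← Finset.sum_filter]
  congr 1
  ext i
  have := pos_le m φ W
  simp only [Finset.mem_filter, Finset.mem_range]
  constructor
  · rintro ⟨h1, h2⟩
    have := (hW.le_ker_iff φ (Nat.lt_succ_iff.1 h1)).1 h2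
    omega
  · intro h
    exact ⟨by omega, (hW.le_ker_iff φ (m := m) (by omega)).2 (by omega)⟩

theorem IsFlag.pos_eq [FiniteDimensional F V] {K : Submodule F V} {W : ℕ → Submodule F V}
    (hW : IsFlag K W) {φ : Dual F V} {i m : ℕ} (hi : i < m) (h : W i ≤ LinearMap.ker φ)
    (h' : ¬ W (i + 1) ≤ LinearMap.ker φ) : pos m φ W = i := by
  have h1 := (hW.le_ker_iff φ hi.le).1 h
  have h2 := (hW.le_ker_iff φ (m := m) hi).not.1 h'
  omega

theorem IsFlag.pos_ins [FiniteDimensional F V] {K : Submodule F V} {ψ : Dual F V} {e : V}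
    (heK : e ∈ K) (he : ψ e = 1) {W : ℕ → Submodule F V}
    (hW : IsFlag (K ⊓ LinearMap.ker ψ) W) {i : ℕ} (hi : i < finrank F K) :
    pos (finrank F K) ψ (Steinberg.ins (Submodule.span F {e}) i W) = i := by
  refine (hW.ins heK he hi).pos_eq hi ?_ ?_
  · rw [ins_of_le _ le_rfl]
    exact (hW.le i).trans inf_le_right
  · rw [ins_of_lt _ (Nat.lt_succ_self i)]
    exact not_sup_span_le he _

theorem IsFlag.pos_map {K : Submodule F V} {W : ℕ → Submodule F V} (hW : IsFlag K W)
    {φ φ' : Dual F V} {g : V →ₗ[F] V} {t : F} (ht : t ≠ 0)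
    (h : ∀ v ∈ K, φ' (g v) = t * φ v) (m : ℕ) :
    pos m φ' (fun j => (W j).map g) = pos m φ W := by
  classical
  have key : ∀ j, (W j).map g ≤ LinearMap.ker φ' ↔ W j ≤ LinearMap.ker φ := by
    intro j
    rw [Submodule.map_le_iff_le_comap]
    refine forall₂_congr fun v hv => ?_
    simp [h v (hW.le j hv), ht]
  simp only [pos, key]

end Position

/-- Suspension turns weights on `K` into partial sums of weights on the hyperplane; taking
differences inverts this over any abelian group. -/
theorem exists_sum_range_eq {A : Type*} [AddCommGroup A] (c : ℕ → A) :
    ∃ d : ℕ → A, ∀ j, ∑ i ∈ Finset.range (j + 1), d i = c j := by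
  refine ⟨fun i => c i - if i = 0 then 0 else c (i - 1), fun j => ?_⟩
  induction j with
  | zero => simp
  | succ j ih => rw [Finset.sum_range_succ, ih]; simp

/-- `K` is not the union of two proper subspaces, so some `u ∈ K` has `φ u ≠ 0` and `φ' u ≠ 0`.
Adding to `v` the multiple of `u` that corrects `φ' v` to `φ v` gives the map. -/
theorem exists_linearMap_comp_eq {K : Submodule F V} {φ φ' : Dual F V}
    (h : ∃ v ∈ K, φ v ≠ 0) (h' : ∃ v ∈ K, φ' v ≠ 0) :
    ∃ g : V →ₗ[F] V, (∀ v ∈ K, g v ∈ K) ∧ (∀ v ∈ K, g v = 0 → v = 0) ∧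
      ∀ v, φ' (g v) = φ v := by
  obtain ⟨u, hu, hu1, hu2⟩ : ∃ u ∈ K, φ u ≠ 0 ∧ φ' u ≠ 0 := by
    obtain ⟨a, ha, ha'⟩ := h
    obtain ⟨b, hb, hb'⟩ := h'
    by_cases h1 : φ' a = 0
    · by_cases h2 : φ b = 0
      · exact ⟨a + b, K.add_mem ha hb, by simpa [h2] using ha', by simpa [h1] using hb'⟩
      · exact ⟨b, hb, h2, hb'⟩
    · exact ⟨a, ha, ha', h1⟩
  refine ⟨shear ((φ' u)⁻¹ • (φ - φ')) u, fun v hv => K.add_mem hv (K.smul_mem _ hu), ?_, ?_⟩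
  · intro v _ hv
    have h1 : φ v = 0 := by
      have := congrArg φ' hv
      simp only [shear_apply, LinearMap.smul_apply, LinearMap.sub_apply, map_add, map_smul,
        smul_eq_mul, map_zero] at this
      field_simp at this
      simpa using this
    rw [shear_apply, LinearMap.smul_apply] at hv
    have h2 := congrArg φ hv
    rw [map_add, map_smul, h1, zero_add, map_zero, smul_eq_mul, mul_eq_zero,
      or_iff_left hu1] at h2
    rwa [h2, zero_smul, add_zero] at hv
  · intro v
    simp only [shear_apply, LinearMap.smul_apply, LinearMap.sub_apply, map_add, map_smul,
      smul_eq_mul]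
    field_simp
    ring

/-- A biadditive function on the Steinberg module of `K` which is invariant under the linear
automorphisms of `K` that preserve `φ` up to a nonzero scalar. -/
structure IsInvariant {A : Type*} [AddCommGroup A] (K : Submodule F V) (φ : Dual F V)
    (B : ((ℕ → Submodule F V) →₀ ℤ) → ((ℕ → Submodule F V) →₀ ℤ) → A) : Prop where
  add_left : ∀ x ∈ flagCycles K, ∀ x' ∈ flagCycles K, ∀ y ∈ flagCycles K,
    B (x + x') y = B x y + B x' y
  add_right : ∀ x ∈ flagCycles K, ∀ y ∈ flagCycles K, ∀ y' ∈ flagCycles K,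
    B x (y + y') = B x y + B x y'
  inv : ∀ (g : V →ₗ[F] V) (t : F), t ≠ 0 → (∀ v ∈ K, g v ∈ K) → (∀ v ∈ K, g v = 0 → v = 0) →
    (∀ v ∈ K, φ (g v) = t * φ v) → ∀ x ∈ flagCycles K, ∀ y ∈ flagCycles K,
    B (act g x) (act g y) = B x y

/-! ### Classification of the invariant forms -/

section Induction

variable {A : Type*} [AddCommGroup A] {K : Submodule F V}
  {ψ φ : Dual F V} {e : V}
  {B : ((ℕ → Submodule F V) →₀ ℤ) → ((ℕ → Submodule F V) →₀ ℤ) → A}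

theorem IsInvariant.zero_left (hB : IsInvariant K φ B) {y : (ℕ → Submodule F V) →₀ ℤ}
    (hy : y ∈ flagCycles K) : B 0 y = 0 := by
  simpa using hB.add_left 0 (zero_mem _) 0 (zero_mem _) y hy

theorem IsInvariant.zero_right (hB : IsInvariant K φ B) {x : (ℕ → Submodule F V) →₀ ℤ}
    (hx : x ∈ flagCycles K) : B x 0 = 0 := by
  simpa using hB.add_right x hx 0 (zero_mem _) 0 (zero_mem _)

theorem eq_weightedPairing_of_left {w : (ℕ → Submodule F V) → A} (hB : IsInvariant K φ B)
    {ι : Type*} {S : ι → Submodule ℤ ((ℕ → Submodule F V) →₀ ℤ)} (hS : flagCycles K ≤ ⨆ i, S i)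
    (hS' : ∀ i, S i ≤ flagCycles K) {y : (ℕ → Submodule F V) →₀ ℤ} (hy : y ∈ flagCycles K)
    (h : ∀ i, ∀ x ∈ S i, B x y = weightedPairing w x y) {x : (ℕ → Submodule F V) →₀ ℤ}
    (hx : x ∈ flagCycles K) : B x y = weightedPairing w x y := by
  refine (Submodule.iSup_induction S (motive := fun x => x ∈ flagCycles K ∧
    B x y = weightedPairing w x y) (hS hx) (fun i x hx => ⟨hS' i hx, h i x hx⟩)
    ⟨zero_mem _, by simp [hB.zero_left hy]⟩ ?_).2
  rintro x x' ⟨hx, hxB⟩ ⟨hx', hxB'⟩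
  exact ⟨add_mem hx hx', by rw [hB.add_left x hx x' hx' y hy, hxB, hxB', map_add]; rfl⟩

theorem eq_weightedPairing_of_right {w : (ℕ → Submodule F V) → A} (hB : IsInvariant K φ B)
    {ι : Type*} {S : ι → Submodule ℤ ((ℕ → Submodule F V) →₀ ℤ)} (hS : flagCycles K ≤ ⨆ i, S i)
    (hS' : ∀ i, S i ≤ flagCycles K) {x : (ℕ → Submodule F V) →₀ ℤ} (hx : x ∈ flagCycles K)
    (h : ∀ i, ∀ y ∈ S i, B x y = weightedPairing w x y) {y : (ℕ → Submodule F V) →₀ ℤ}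
    (hy : y ∈ flagCycles K) : B x y = weightedPairing w x y := by
  refine (Submodule.iSup_induction S (motive := fun y => y ∈ flagCycles K ∧
    B x y = weightedPairing w x y) (hS hy) (fun i y hy => ⟨hS' i hy, h i y hy⟩)
    ⟨zero_mem _, by simp [hB.zero_right hx]⟩ ?_).2
  rintro y y' ⟨hy, hyB⟩ ⟨hy', hyB'⟩
  exact ⟨add_mem hy hy', by rw [hB.add_right x hx y hy y' hy', hyB, hyB', map_add]⟩

theorem shear_injOn (he : ψ e = 1) {H : Submodule F V} (hH : H ≤ LinearMap.ker ψ) :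
    ∀ v ∈ H, shear φ e v = 0 → v = 0 := by
  intro v hv h
  have h1 : ψ v = 0 := hH hv
  have h2 := congrArg ψ h
  simp only [shear_apply, map_add, map_smul, h1, he, smul_eq_mul, mul_one, zero_add,
    map_zero] at h2
  simpa [shear_apply, h2] using h

/-- The functional `ψ - φ` takes the value `ψ v` at `v + φ(v) e`, so the shear carries one
complement of the line of `e` onto the other. -/
theorem act_shear_mem [FiniteDimensional F V] (heK : e ∈ K) (he : ψ e = 1) (hφ : φ e = 0)
    {y : (ℕ → Submodule F V) →₀ ℤ} (hy : y ∈ flagCycles (K ⊓ LinearMap.ker ψ)) :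
    act (shear φ e) y ∈ flagCycles (K ⊓ LinearMap.ker (ψ - φ)) := by
  have he' : (ψ - φ) e = 1 := by simp [he, hφ]
  refine act_mem (K := K ⊓ LinearMap.ker ψ) (K' := K ⊓ LinearMap.ker (ψ - φ))
    (fun v hv => ⟨K.add_mem hv.1 (K.smul_mem _ heK), ?_⟩)
    (shear_injOn he inf_le_right) ?_ hy
  · have : ψ v = 0 := hv.2
    simp [shear_apply, this, he, hφ]
  · have h1 := finrank_inf_ker_of_mem he heK
    have h2 := finrank_inf_ker_of_mem he' heK
    omega

theorem susp_act_shear_mem [FiniteDimensional F V] (heK : e ∈ K) (he : ψ e = 1) (hφ : φ e = 0)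
    {y : (ℕ → Submodule F V) →₀ ℤ} (hy : y ∈ flagCycles (K ⊓ LinearMap.ker ψ)) :
    susp (Submodule.span F {e}) (finrank F K) (act (shear φ e) y) ∈ flagCycles K :=
  susp_mem (ψ := ψ - φ) heK (by simp [he, hφ]) (act_shear_mem heK he hφ hy)

/-- The extension of `g` from the kernel of `ψ` by `e ↦ t e`. -/
def extend (ψ : Dual F V) (e : V) (g : V →ₗ[F] V) (t : F) : V →ₗ[F] V :=
  g ∘ₗ (LinearMap.id - ψ.smulRight e) + t • ψ.smulRight e

theorem extend_apply (g : V →ₗ[F] V) (t : F) (v : V) :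
    extend ψ e g t v = g (v - ψ v • e) + t • ψ v • e := rfl

theorem extend_apply_of_mem {v : V} (hv : v ∈ LinearMap.ker ψ) (g : V →ₗ[F] V) (t : F) :
    extend ψ e g t v = g v := by
  simp [extend_apply, LinearMap.mem_ker.1 hv]

theorem extend_apply_self (he : ψ e = 1) (g : V →ₗ[F] V) (t : F) :
    extend ψ e g t e = t • e := by
  simp [extend_apply, he]

theorem sub_smul_mem (heK : e ∈ K) (he : ψ e = 1) {v : V} (hv : v ∈ K) :
    v - ψ v • e ∈ K ⊓ LinearMap.ker ψ :=
  ⟨K.sub_mem hv (K.smul_mem _ heK), by simp [he]⟩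

theorem exists_dual_eq_one {e : V} (he : e ≠ 0) : ∃ ψ : Dual F V, ψ e = 1 := by
  obtain ⟨ψ, hψ⟩ := Projective.exists_dual_ne_zero F he
  exact ⟨(ψ e)⁻¹ • ψ, by simp [hψ]⟩

theorem isFlag_bot : IsFlag (⊥ : Submodule F V) fun _ => ⊥ where
  mono _ _ _ := le_rfl
  le _ := le_rfl
  rank _ := by simp

theorem IsFlag.eq_bot {W : ℕ → Submodule F V} (hW : IsFlag (⊥ : Submodule F V) W) :
    W = fun _ => ⊥ :=
  funext fun j => le_bot_iff.1 (hW.le j)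

theorem single_bot_mem_flagCycles :
    Finsupp.single (fun _ => ⊥) 1 ∈ flagCycles (⊥ : Submodule F V) := by
  refine mem_flagCycles.2 ⟨fun W hW => ?_, fun i _ hi' => ?_⟩
  · rw [Finset.mem_singleton.1 (Finsupp.support_single_subset hW)]
    exact isFlag_bot
  · simp at hi'

theorem isInvariant_weightedPairing (m : ℕ) (c : ℕ → A) :
    IsInvariant K φ fun x y => weightedPairing (fun W => c (pos m φ W)) x y where
  add_left x _ x' _ y _ := by simp
  add_right x _ y _ y' _ := by simp
  inv g t ht _ hg h x hx y hy := by
    rw [weightedPairing_act hg _ hx hy]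
    exact weightedPairing_congr
      (fun W hW => by rw [((mem_flagCycles.1 hx).1 W hW).pos_map ht h]) y

variable [FiniteDimensional F V]

/-- Comparison of the forms obtained by suspending, under a change of the complement. -/
theorem IsInvariant.susp_eq (hB : IsInvariant K ψ B) (heK : e ∈ K) (he : ψ e = 1)
    {φ φ' : Dual F V} (hφ : φ e = 0) {g : V →ₗ[F] V} {t : F} (ht : t ≠ 0)
    (hgK : ∀ v ∈ K ⊓ LinearMap.ker ψ, g v ∈ K ⊓ LinearMap.ker ψ)
    (hg : ∀ v ∈ K ⊓ LinearMap.ker ψ, g v = 0 → v = 0)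
    (h : ∀ v ∈ K ⊓ LinearMap.ker ψ, φ' (g v) = t * φ v)
    {x y : (ℕ → Submodule F V) →₀ ℤ} (hx : x ∈ flagCycles (K ⊓ LinearMap.ker ψ))
    (hy : y ∈ flagCycles (K ⊓ LinearMap.ker ψ)) :
    B (susp (Submodule.span F {e}) (finrank F K) (act g x))
      (susp (Submodule.span F {e}) (finrank F K) (act (shear φ' e) (act g y))) =
    B (susp (Submodule.span F {e}) (finrank F K) x)
      (susp (Submodule.span F {e}) (finrank F K) (act (shear φ e) y)) := by
  have hspan : (Submodule.span F {e}).map (extend ψ e g t) = Submodule.span F {e} := by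
    rw [Submodule.map_span, Set.image_singleton, extend_apply_self he,
      Submodule.span_singleton_smul_eq (IsUnit.mk0 t ht)]
  have hψ : ∀ v ∈ K, ψ (extend ψ e g t v) = t * ψ v := by
    intro v hv
    have : ψ (g (v - ψ v • e)) = 0 := (hgK _ (sub_smul_mem heK he hv)).2
    rw [extend_apply, map_add, this]
    simp [he]
  rw [← hB.inv (extend ψ e g t) t ht _ _ hψ _ (susp_mem heK he hx) _
    (susp_act_shear_mem heK he hφ hy), act_susp, act_susp, hspan]
  · congr 2
    · exact act_congr (K := K ⊓ LinearMap.ker ψ)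
        (fun v hv => (extend_apply_of_mem hv.2 g t).symm) hx
    -- The extension sends `e` to `t e`, and `φ' ∘ g = t φ` on the hyperplane. Hence it intertwines
    -- the shear by `φ` with the shear by `φ'`.
    · rw [← act_comp, ← act_comp]
      refine act_congr (K := K ⊓ LinearMap.ker ψ) (fun v hv => ?_) hy
      rw [LinearMap.comp_apply, LinearMap.comp_apply, shear_apply, shear_apply, map_add, map_smul,
        extend_apply_of_mem hv.2, extend_apply_self he, h v hv, smul_smul, mul_comm]
  · intro v hv
    exact K.add_mem (hgK _ (sub_smul_mem heK he hv)).1 (K.smul_mem _ (K.smul_mem _ heK))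
  · intro v hv hv0
    have h1 : ψ v = 0 := by
      have := hψ v hv
      rw [hv0, map_zero] at this
      simpa [ht] using this.symm
    rw [extend_apply_of_mem h1] at hv0
    exact hg v ⟨hv, h1⟩ hv0

theorem IsInvariant.susp (hB : IsInvariant K ψ B) (heK : e ∈ K) (he : ψ e = 1) (hφ : φ e = 0) :
    IsInvariant (K ⊓ LinearMap.ker ψ) φ fun x y =>
      B (susp (Submodule.span F {e}) (finrank F K) x)
        (susp (Submodule.span F {e}) (finrank F K) (act (shear φ e) y)) where
  add_left x hx x' hx' y hy := by
    simp only [map_add]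
    exact hB.add_left _ (susp_mem heK he hx) _ (susp_mem heK he hx') _
      (susp_act_shear_mem heK he hφ hy)
  add_right x hx y hy y' hy' := by
    simp only [map_add]
    exact hB.add_right _ (susp_mem heK he hx) _ (susp_act_shear_mem heK he hφ hy) _
      (susp_act_shear_mem heK he hφ hy')
  inv g t ht hgK hg h x hx y hy := hB.susp_eq heK he hφ ht hgK hg h hx hy

/-- The hypothesis of the induction: the invariant forms are the pairings with weights that depend
only on the position relative to the kernel of `φ`. -/
def InvariantsArePairings (A : Type*) [AddCommGroup A] (K : Submodule F V) (φ : Dual F V) : Prop :=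
  ∀ B : ((ℕ → Submodule F V) →₀ ℤ) → ((ℕ → Submodule F V) →₀ ℤ) → A, IsInvariant K φ B →
    ∃ c : ℕ → A, ∀ x ∈ flagCycles K, ∀ y ∈ flagCycles K,
      B x y = weightedPairing (fun W => c (pos (finrank F K) φ W)) x y

/-- Any two functionals that are nonzero on `H` are conjugate under `GL(H)`, so they share their
weights, and only positions below `dim H` occur for them. For functionals vanishing on `H` only the
position `dim H` occurs. The two sets of weights therefore never conflict and can be glued. -/
theorem IsInvariant.exists_uniform_weight (hB : IsInvariant K ψ B) (heK : e ∈ K) (he : ψ e = 1)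
    (ih : ∀ φ : Dual F V, InvariantsArePairings A (K ⊓ LinearMap.ker ψ) φ) :
    ∃ c : ℕ → A, ∀ φ : Dual F V, φ e = 0 → ∀ x ∈ flagCycles (K ⊓ LinearMap.ker ψ),
      ∀ y ∈ flagCycles (K ⊓ LinearMap.ker ψ),
        B (Steinberg.susp (Submodule.span F {e}) (finrank F K) x)
          (Steinberg.susp (Submodule.span F {e}) (finrank F K) (act (shear φ e) y)) =
        weightedPairing
          (fun W => c (pos (finrank F ↥(K ⊓ LinearMap.ker ψ)) φ W)) x y := by
  set H := K ⊓ LinearMap.ker ψ with hH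
  obtain ⟨c₀, hc₀⟩ := ih 0 _ (hB.susp heK he (φ := 0) rfl)
  have hzero : ∀ φ : Dual F V, (∀ v ∈ H, φ v = 0) → ∀ x ∈ flagCycles H, ∀ y ∈ flagCycles H,
      ∀ c : ℕ → A, c (finrank F H) = c₀ (finrank F H) →
        B (Steinberg.susp (Submodule.span F {e}) (finrank F K) x)
          (Steinberg.susp (Submodule.span F {e}) (finrank F K) (act (shear φ e) y)) =
        weightedPairing (fun W => c (pos (finrank F H) φ W)) x y := by
    intro φ hφ x hx y hy c hc
    have hpos : ∀ χ : Dual F V, (∀ v ∈ H, χ v = 0) → ∀ W ∈ x.support,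
        pos (finrank F H) χ W = finrank F H := by
      intro χ hχ W hW
      have hflag := (mem_flagCycles.1 hx).1 W hW
      exact le_antisymm (pos_le _ _ _) ((hflag.le_ker_iff χ le_rfl).1
        fun v hv => hχ v (hflag.le _ hv))
    rw [act_congr (h := shear 0 e) (fun v hv => by simp [shear_apply, hφ v hv]) hy]
    refine (hc₀ x hx y hy).trans (weightedPairing_congr (fun W hW => ?_) y)
    rw [hpos φ hφ W hW, hpos 0 (fun _ _ => rfl) W hW, hc]
  by_cases hex : ∃ φ₀ : Dual F V, φ₀ e = 0 ∧ ∃ v ∈ H, φ₀ v ≠ 0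
  · obtain ⟨φ₀, hφ₀, hne₀⟩ := hex
    obtain ⟨c₁, hc₁⟩ := ih φ₀ _ (hB.susp heK he hφ₀)
    obtain ⟨c, hc, hc'⟩ : ∃ c : ℕ → A, (∀ j < finrank F H, c j = c₁ j) ∧
        c (finrank F H) = c₀ (finrank F H) :=
      ⟨fun j => if j < finrank F H then c₁ j else c₀ j, fun j hj => if_pos hj,
        if_neg (lt_irrefl _)⟩
    refine ⟨c, fun φ hφ x hx y hy => ?_⟩
    by_cases hne : ∃ v ∈ H, φ v ≠ 0
    · obtain ⟨g, hgH, hg, hgφ⟩ := exists_linearMap_comp_eq hne hne₀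
      rw [← hB.susp_eq heK he hφ one_ne_zero hgH hg (φ' := φ₀) (fun v _ => by rw [hgφ, one_mul])
        hx hy]
      refine (hc₁ _ (act_mem hgH hg rfl hx) _ (act_mem hgH hg rfl hy)).trans ?_
      rw [weightedPairing_act hg _ hx hy]
      refine weightedPairing_congr (fun W hW => ?_) y
      have hflag := (mem_flagCycles.1 hx).1 W hW
      rw [hflag.pos_map one_ne_zero (φ := φ) (fun v _ => by rw [hgφ, one_mul])]
      refine (hc _ ?_).symm
      refine lt_of_le_of_ne (pos_le _ _ _) fun heq => ?_
      obtain ⟨v, hv, hv'⟩ := hne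
      refine hv' ((hflag.le_ker_iff φ le_rfl).2 heq.ge ?_)
      rwa [hflag.top le_rfl]
    · push Not at hne
      exact hzero φ hne x hx y hy c hc'
  · push Not at hex
    exact ⟨c₀, fun φ hφ x hx y hy => hzero φ (hex φ hφ) x hx y hy c₀ rfl⟩

/-- With `d` chosen so that its partial sums are the uniform weights, `B` and the pairing weighted
by `d` agree on a suspension against a sheared suspension. The two spanning theorems extend this to
all cycles, first on the right and then on the left. -/
theorem invariantsArePairings_of_ne_zero (heK : e ∈ K) (he : ψ e = 1)
    (ih : ∀ φ : Dual F V, InvariantsArePairings A (K ⊓ LinearMap.ker ψ) φ) :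
    InvariantsArePairings A K ψ := by
  classical
  intro B hB
  obtain ⟨c, hc⟩ := hB.exists_uniform_weight heK he ih
  obtain ⟨d, hd⟩ := exists_sum_range_eq c
  have hr := finrank_inf_ker_of_mem he heK
  have he0 : e ≠ 0 := fun h => by simp [h] at he
  refine ⟨d, ?_⟩
  have hinv := isInvariant_weightedPairing (K := K) (φ := ψ) (finrank F K) d
  have hshear : ∀ φ : Dual F V, φ e = 0 → ∀ x ∈ flagCycles (K ⊓ LinearMap.ker ψ),
      ∀ y ∈ flagCycles (K ⊓ LinearMap.ker ψ),
      B (susp (Submodule.span F {e}) (finrank F K) x)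
          (susp (Submodule.span F {e}) (finrank F K) (act (shear φ e) y)) =
        weightedPairing (fun W => d (pos (finrank F K) ψ W))
          (susp (Submodule.span F {e}) (finrank F K) x)
          (susp (Submodule.span F {e}) (finrank F K) (act (shear φ e) y)) := by
    intro φ hφ x hx y hy
    rw [hc φ hφ x hx y hy, weightedPairing_susp he hφ inf_le_right _ _ hx hy]
    refine weightedPairing_congr (fun W hW => ?_) y
    have hflag := (mem_flagCycles.1 hx).1 W hW
    rw [← hd, ← hflag.sum_pos, hr]
    refine Finset.sum_congr rfl fun i hi => ?_
    rw [hflag.pos_ins heK he (Finset.mem_range.1 hi)]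
  have hleft : ∀ x ∈ flagCycles (K ⊓ LinearMap.ker ψ), ∀ y ∈ flagCycles K,
      B (susp (Submodule.span F {e}) (finrank F K) x) y =
        weightedPairing (fun W => d (pos (finrank F K) ψ W))
          (susp (Submodule.span F {e}) (finrank F K) x) y := by
    intro x hx y hy
    refine eq_weightedPairing_of_right hB (flagCycles_le_iSup_dual heK he0) ?_
      (susp_mem heK he hx) ?_ hy
    · rintro ⟨ψ', he'⟩ _ ⟨y, hy, rfl⟩
      exact susp_mem heK he' hy
    · rintro ⟨ψ', he'⟩ _ ⟨y, hy, rfl⟩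
      -- Every cycle of `K ∩ ker ψ'` is the shear by `ψ - ψ'` of a cycle of `K ∩ ker ψ`, obtained by
      -- the opposite shear.
      have hback := act_shear_mem (φ := ψ' - ψ) heK he' (by simp [he, he']) hy
      rw [sub_sub_cancel] at hback
      have hy' : act (shear (ψ - ψ') e) (act (shear (ψ' - ψ) e) y) = y := by
        rw [← act_comp]
        refine act_eq_self (fun v _ => ?_) hy
        simp [shear_apply, he, he', sub_smul]
        abel
      have := hshear (ψ - ψ') (by simp [he, he']) x hx _ hback
      rwa [hy'] at this
  intro x hx y hy
  have hK : ¬ K ≤ LinearMap.ker ψ := fun h => by simp [LinearMap.mem_ker.1 (h heK)] at he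
  refine eq_weightedPairing_of_left hB (flagCycles_le_iSup_vector hK) ?_ hy ?_ hx
  · rintro ⟨e', heK', he'⟩ _ ⟨x, hx, rfl⟩
    exact susp_mem heK' he' hx
  · rintro ⟨e', heK', he'⟩ _ ⟨x, hx, rfl⟩
    -- This shear preserves `ψ`, fixes `ker ψ` pointwise and sends `e'` to `e`. As both forms are
    -- invariant under it, the left argument can be taken to be a suspension by `e`.
    have hψ : ∀ v, ψ (shear ψ (e - e') v) = ψ v := fun v => by simp [shear_apply, he, he']
    have hK : ∀ v ∈ K, shear ψ (e - e') v ∈ K := fun v hv =>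
      K.add_mem hv (K.smul_mem _ (K.sub_mem heK heK'))
    have hinj : ∀ v ∈ K, shear ψ (e - e') v = 0 → v = 0 := by
      intro v _ hv
      have h0 := hψ v
      rw [hv, map_zero] at h0
      simpa [shear_apply, ← h0] using hv
    have hact : act (shear ψ (e - e')) (susp (Submodule.span F {e'}) (finrank F K) x) =
        susp (Submodule.span F {e}) (finrank F K) x := by
      rw [act_susp, Submodule.map_span, Set.image_singleton]
      congr 3
      · simp [shear_apply, he']
      · exact act_eq_self (fun v hv => by simp [shear_apply, LinearMap.mem_ker.1 hv.2]) hx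
    have h1 := hB.inv _ 1 one_ne_zero hK hinj (fun v _ => by rw [hψ, one_mul]) _
      (susp_mem heK' he' hx) y hy
    have h2 := hinv.inv _ 1 one_ne_zero hK hinj (fun v _ => by rw [hψ, one_mul]) _
      (susp_mem heK' he' hx) y hy
    rw [← h1]
    refine Eq.trans ?_ h2
    rw [hact]
    exact hleft x hx _ (act_mem hK hinj rfl hy)

/-- There are two cycles with exactly one common flag. -/
theorem exists_pair (A : Type*) [AddCommGroup A] (m : ℕ) :
    ∀ K : Submodule F V, finrank F K = m → ∃ a ∈ flagCycles K, ∃ b ∈ flagCycles K,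
      ∃ W, IsFlag K W ∧ ∀ w : (ℕ → Submodule F V) → A, weightedPairing w a b = w W := by
  classical
  induction m with
  | zero =>
    intro K hK
    obtain rfl := Submodule.finrank_eq_zero.1 hK
    exact ⟨_, single_bot_mem_flagCycles, _, single_bot_mem_flagCycles, _, isFlag_bot,
      fun w => by rw [weightedPairing_single_single, if_pos rfl]⟩
  | succ m ih =>
    intro K hK
    have hne : K ≠ ⊥ := by
      rintro rfl
      simp at hK
    obtain ⟨e, heK, he0⟩ := K.ne_bot_iff.1 hne
    obtain ⟨ψ, he⟩ := exists_dual_eq_one (F := F) he0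
    have hr := finrank_inf_ker_of_mem he heK
    obtain ⟨a, ha, b, hb, W, hW, hw⟩ := ih (K ⊓ LinearMap.ker ψ) (by omega)
    -- A functional that kills `e` but not the line `W 1` leaves only the insertion at `0`, so the
    -- suspensions again share exactly one flag.
    obtain ⟨φ, hφ, hφW⟩ : ∃ φ : Dual F V, φ e = 0 ∧ ∀ i, 0 < i → i ≤ m →
        ¬ W i ≤ LinearMap.ker φ := by
      rcases Nat.eq_zero_or_pos m with rfl | hm
      · exact ⟨0, rfl, fun i hi hi' => by omega⟩
      · obtain ⟨v, hv, hv0⟩ := (W 1).ne_bot_iff.1 fun h => by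
          have := hW.rank 1
          rw [h, finrank_bot] at this
          omega
        obtain ⟨χ, hχ⟩ := exists_dual_eq_one (F := F) hv0
        refine ⟨χ - χ e • ψ, by simp [he], fun i hi _ h => ?_⟩
        have h1 := LinearMap.mem_ker.1 (h (hW.mono hi hv))
        have h2 : ψ v = 0 := (hW.le 1 hv).2
        simp [hχ, h2] at h1
    refine ⟨_, susp_mem heK he ha, _, susp_act_shear_mem heK he hφ hb,
      Steinberg.ins (Submodule.span F {e}) 0 W, hW.ins heK he (by omega), fun w => ?_⟩
    rw [weightedPairing_susp he hφ inf_le_right _ _ ha hb, hw, hK, Finset.sum_eq_single 0]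
    · rw [if_pos]
      rw [hW.zero]
      exact bot_le
    · intro i hi hi0
      rw [if_neg (hφW i (by omega) (by simpa [Nat.lt_succ_iff] using hi))]
    · simp

/-- On a pair of cycles whose only common flag is `W`, the form takes the value `d (pos W)`.
Automorphisms of `K` bring `W` to any position below `dim K` without changing that value, so `d` is
constant there. Position `dim K` does not occur, as `ψ` is nonzero on `K`. -/
theorem InvariantsArePairings.exists_eq_smul (hK : InvariantsArePairings A K ψ) (heK : e ∈ K)
    (he : ψ e = 1) (hB : IsInvariant K 0 B) :
    ∃ r : A, ∀ x ∈ flagCycles K, ∀ y ∈ flagCycles K,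
      B x y = weightedPairing (fun _ => r) x y := by
  obtain ⟨d, hd⟩ := hK B ⟨hB.add_left, hB.add_right, fun g t ht hgK hg _ =>
    hB.inv g t ht hgK hg (by simp)⟩
  obtain ⟨a, ha, b, hb, W, hW, hw⟩ := exists_pair (F := F) A _ K rfl
  have hr := finrank_inf_ker_of_mem he heK
  have hdi : ∀ i, i < finrank F K → d i = B a b := by
    intro i hi
    -- Relative to this `φ` the flag has position `i`; moving `φ` to `ψ` by an automorphism of `K`
    -- gives the flag position `i` relative to `ψ`.
    obtain ⟨φ, hφ, hφ'⟩ : ∃ φ : Dual F V, W i ≤ LinearMap.ker φ ∧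
        ¬ W (i + 1) ≤ LinearMap.ker φ := by
      obtain ⟨v, hv, hv'⟩ := SetLike.exists_of_lt (lt_of_le_of_ne (hW.mono (Nat.le_succ i))
        fun h => by
          have h1 := hW.rank i
          have h2 := hW.rank (i + 1)
          rw [← h, h1] at h2
          omega)
      obtain ⟨φ, hφ, hφ'⟩ := Submodule.exists_dual_map_eq_bot_of_notMem hv' inferInstance
      exact ⟨φ, LinearMap.le_ker_iff_map.2 hφ', fun h => hφ (h hv)⟩
    obtain ⟨g, hgK, hg, hgφ⟩ := exists_linearMap_comp_eq (K := K) (φ := φ) (φ' := ψ)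
      (by
        obtain ⟨v, hv, hv'⟩ := Set.not_subset.1 hφ'
        exact ⟨v, hW.le _ hv, hv'⟩) ⟨e, heK, by simp [he]⟩
    rw [← hB.inv g 1 one_ne_zero hgK hg (by simp) a ha b hb,
      hd _ (act_mem hgK hg rfl ha) _ (act_mem hgK hg rfl hb), weightedPairing_act hg _ ha hb, hw,
      hW.pos_map one_ne_zero (φ := φ) (fun v _ => by rw [hgφ, one_mul]), hW.pos_eq hi hφ hφ']
  refine ⟨B a b, fun x hx y hy => ?_⟩
  rw [hd x hx y hy]
  refine weightedPairing_congr (fun W hW => hdi _ ?_) y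
  have hflag := (mem_flagCycles.1 hx).1 W hW
  refine lt_of_le_of_ne (pos_le _ _ _) fun h => ?_
  have h1 := (hflag.le_ker_iff ψ le_rfl).2 h.ge
  rw [hflag.top le_rfl] at h1
  simp [LinearMap.mem_ker.1 (h1 heK)] at he

theorem invariantsArePairings (A : Type*) [AddCommGroup A] (m : ℕ) :
    ∀ K : Submodule F V, finrank F K = m → ∀ φ : Dual F V, InvariantsArePairings A K φ := by
  classical
  induction m with
  | zero =>
    intro K hK φ B hB
    obtain rfl := Submodule.finrank_eq_zero.1 hK
    have hsingle : ∀ x ∈ flagCycles (⊥ : Submodule F V),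
        ∃ a : ℤ, x = a • Finsupp.single (fun _ => ⊥) 1 := by
      intro x hx
      obtain ⟨a, rfl⟩ := Finsupp.support_subset_singleton'.1 fun W hW =>
        Finset.mem_singleton.2 ((mem_flagCycles.1 hx).1 W hW).eq_bot
      exact ⟨a, by simp⟩
    have hmem : Finsupp.single (fun _ => ⊥) 1 ∈ flagCycles (⊥ : Submodule F V) :=
      single_bot_mem_flagCycles
    set s : (ℕ → Submodule F V) →₀ ℤ := Finsupp.single (fun _ => ⊥) 1
    refine ⟨fun _ => B s s, fun x hx y hy => ?_⟩
    obtain ⟨a, rfl⟩ := hsingle x hx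
    obtain ⟨b, rfl⟩ := hsingle y hy
    let L : flagCycles (⊥ : Submodule F V) →+ A :=
      AddMonoidHom.mk' (fun x => B x (b • s)) fun x x' => hB.add_left _ x.2 _ x'.2 _ hy
    let R : flagCycles (⊥ : Submodule F V) →+ A :=
      AddMonoidHom.mk' (fun y => B s y) fun y y' => hB.add_right _ hmem _ y.2 _ y'.2
    have hL : B (a • s) (b • s) = a • B s (b • s) := map_zsmul L a ⟨s, hmem⟩
    have hR : B s (b • s) = b • B s s := map_zsmul R b ⟨s, hmem⟩
    rw [hL, hR, map_smul, map_smul, LinearMap.smul_apply, weightedPairing_single_single,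
      if_pos rfl, smul_comm]
  | succ m ih =>
    intro K hK φ B hB
    by_cases hφ : ∃ v ∈ K, φ v ≠ 0
    · obtain ⟨e, heK, he⟩ := exists_mem_eq_one (N := K) (ψ := φ) fun h => by
        obtain ⟨v, hv, hv'⟩ := hφ
        exact hv' (h hv)
      have hr := finrank_inf_ker_of_mem he heK
      exact invariantsArePairings_of_ne_zero heK he (ih _ (by omega)) B hB
    -- Here `φ` vanishes on `K`, so `B` is invariant under all automorphisms of `K`, and an
    -- auxiliary `ψ` that is nonzero on `K` may be used.
    · push Not at hφ
      have hne : K ≠ ⊥ := by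
        rintro rfl
        simp at hK
      obtain ⟨e, heK, he0⟩ := K.ne_bot_iff.1 hne
      obtain ⟨ψ, he⟩ := exists_dual_eq_one (F := F) he0
      have hr := finrank_inf_ker_of_mem he heK
      obtain ⟨r, hr⟩ := (invariantsArePairings_of_ne_zero heK he
        (ih _ (by omega))).exists_eq_smul heK he (B := B) ⟨hB.add_left, hB.add_right,
          fun g t ht hgK hg _ => hB.inv g t ht hgK hg
            (fun v hv => by rw [hφ v hv, hφ _ (hgK v hv), mul_zero])⟩
      exact ⟨fun _ => r, hr⟩

end Induction

/-! ### The simplicial boundary, face by face -/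

section Boundary

theorem mapDomain_eq_zero_of_factors {α β γ : Type*} [Nonempty γ] {f : α → β} {g : α → γ}
    (h : ∀ a b, f a = f b → g a = g b) {z : α →₀ ℤ} (hz : Finsupp.mapDomain f z = 0) :
    Finsupp.mapDomain g z = 0 := by
  obtain ⟨e, rfl⟩ := (Function.factorsThrough_iff g).1 fun a b => h a b
  rw [Finsupp.mapDomain_comp, hz, Finsupp.mapDomain_zero]

variable {P : Type*} [PartialOrder P]

/-- The face of a chain that omits the `i`-th vertex. -/
def face {k : ℕ} (i : Fin (k + 1)) (c : Fin (k + 1) ↪o P) : Fin k ↪o P :=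
  (Fin.succAboveOrderEmb i).trans c

theorem boundary_apply {k : ℕ} (z : Chains P (k + 1)) :
    boundary P k z = ∑ i : Fin (k + 1), (-1 : ℤ) ^ (i : ℕ) • Finsupp.mapDomain (face i) z := by
  have h : boundary P k =
      ∑ i : Fin (k + 1), (-1 : ℤ) ^ (i : ℕ) • Finsupp.lmapDomain ℤ ℤ (face i) := by
    ext c : 2
    simp only [LinearMap.comp_apply, Finsupp.lsingle_apply, boundary,
      Finsupp.linearCombination_single, one_smul, LinearMap.sum_apply, LinearMap.smul_apply,
      Finsupp.lmapDomain_apply, Finsupp.mapDomain_single, Finsupp.smul_single, smul_eq_mul, mul_one]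
    rfl
  rw [h]
  simp only [LinearMap.sum_apply, LinearMap.smul_apply, Finsupp.lmapDomain_apply]

/-- If the vertices of each chain are determined in rank, the faces of a cycle vanish separately. -/
theorem boundary_eq_zero_iff {k : ℕ} (rk : P → ℕ)
    (hrk : ∀ (c : Fin (k + 1) ↪o P) (i : Fin (k + 1)), rk (c i) = i + 1)
    (z : Chains P (k + 1)) :
    boundary P k z = 0 ↔ ∀ i : Fin (k + 1), Finsupp.mapDomain (face i) z = 0 := by
  rw [boundary_apply]
  refine ⟨fun h i => ?_, fun h => Finset.sum_eq_zero fun i _ => by rw [h i, smul_zero]⟩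
  -- At place `i`, the face omitting `i` has a vertex of rank `i + 2`, while the face omitting a
  -- later `j` still has rank `i + 1`.
  have hlt : ∀ (c c' : Fin (k + 1) ↪o P) (i j : Fin (k + 1)), i < j →
      face i c ≠ face j c' := by
    intro c c' i j hij heq
    have hik : (i : ℕ) < k := by
      have := j.2
      have : (i : ℕ) < j := hij
      omega
    have h1 := congrArg rk (DFunLike.congr_fun heq ⟨i, hik⟩)
    change rk (c (i.succAbove ⟨i, hik⟩)) = rk (c' (j.succAbove ⟨i, hik⟩)) at h1
    rw [hrk, hrk, Fin.succAbove_of_le_castSucc _ _ (by simp),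
      Fin.succAbove_of_castSucc_lt _ _ (show (⟨i, hik⟩ : Fin k).castSucc < j from hij)] at h1
    simp at h1
  have hne : ∀ (c c' : Fin (k + 1) ↪o P) (i j : Fin (k + 1)), i ≠ j →
      face i c ≠ face j c' := fun c c' i j hij =>
    (lt_or_gt_of_ne hij).elim (hlt c c' i j) fun h => (hlt c' c j i h).symm
  ext d
  by_cases hd : ∃ c, face i c = d
  · obtain ⟨c, rfl⟩ := hd
    have h0 := DFunLike.congr_fun h (face i c)
    rw [Finsupp.finsetSum_apply, Finset.sum_eq_single i] at h0
    · simpa using h0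
    · intro j _ hj
      rw [Finsupp.smul_apply, mapDomain_apply_eq_zero fun c' _ => hne c' c j i hj, smul_zero]
    · exact fun hi => absurd (Finset.mem_univ i) hi
  · exact mapDomain_apply_eq_zero fun c _ hc => hd ⟨c, hc⟩

end Boundary

/-! ### Comparison with the Tits building -/

section Bridge

/-- Dimensions increase strictly from at least `1` to at most `k` along `k` terms, which squeezes
each of them. -/
theorem finrank_fullFlag [FiniteDimensional F V] {k : ℕ} (hk : finrank F V = k + 1)
    (c : Fin k ↪o TitsBuilding F V) (i : Fin k) : finrank F (c i).1 = i + 1 := by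
  have hlt : ∀ {a b : Fin k}, a < b → finrank F (c a).1 < finrank F (c b).1 := fun h =>
    Submodule.finrank_lt_finrank_of_lt (Subtype.coe_lt_coe.2 (c.strictMono h))
  have hlow : ∀ m : ℕ, ∀ hm : m < k, m + 1 ≤ finrank F (c ⟨m, hm⟩).1 := by
    intro m
    induction m with
    | zero => exact fun hm => Submodule.one_le_finrank_iff.2 (c ⟨0, hm⟩).2.1
    | succ m ih =>
      intro hm
      have h1 := ih (by omega)
      have h2 := hlt (show (⟨m, by omega⟩ : Fin k) < ⟨m + 1, hm⟩ from Nat.lt_succ_self m)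
      omega
  have hupp : ∀ d m : ℕ, m + d + 1 = k → ∀ hm : m < k, finrank F (c ⟨m, hm⟩).1 ≤ m + 1 := by
    intro d
    induction d with
    | zero =>
      intro m hmk hm
      have := Submodule.finrank_lt (c ⟨m, hm⟩).2.2
      omega
    | succ d ih =>
      intro m hmk hm
      have h1 := ih (m + 1) (by omega) (by omega)
      have h2 := hlt (show (⟨m, hm⟩ : Fin k) < ⟨m + 1, by omega⟩ from Nat.lt_succ_self m)
      omega
  exact le_antisymm (hupp (k - 1 - i) i (by omega) i.2) (hlow i i.2)

/-- The sequence `0, W₁, …, W_k, V, V, …` of a chain of `k` subspaces. -/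
def toSeq {k : ℕ} (c : Fin k ↪o TitsBuilding F V) : ℕ → Submodule F V := fun j =>
  if h : 0 < j ∧ j - 1 < k then (c ⟨j - 1, h.2⟩).1 else if j = 0 then ⊥ else ⊤

theorem toSeq_zero {k : ℕ} (c : Fin k ↪o TitsBuilding F V) : toSeq c 0 = ⊥ := by
  simp [toSeq]

theorem toSeq_succ {k : ℕ} (c : Fin k ↪o TitsBuilding F V) (i : Fin k) :
    toSeq c (i + 1) = (c i).1 := by
  simp [toSeq]

theorem toSeq_of_lt {k : ℕ} (c : Fin k ↪o TitsBuilding F V) {j : ℕ} (hj : k < j) :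
    toSeq c j = ⊤ := by
  rw [toSeq, dif_neg (by omega), if_neg (by omega)]

theorem toSeq_cases {k : ℕ} (j : ℕ) : j = 0 ∨ (∃ i : Fin k, j = i + 1) ∨ k < j := by
  rcases Nat.eq_zero_or_pos j with h | h
  · exact Or.inl h
  · rcases lt_or_ge k j with h' | h'
    · exact Or.inr (Or.inr h')
    · exact Or.inr (Or.inl ⟨⟨j - 1, by omega⟩, (Nat.sub_add_cancel h).symm⟩)

theorem toSeq_injective {k : ℕ} :
    Function.Injective (toSeq : (Fin k ↪o TitsBuilding F V) → ℕ → Submodule F V) := by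
  intro c c' h
  ext i : 2
  rw [← toSeq_succ, ← toSeq_succ, h]

theorem isFlag_toSeq [FiniteDimensional F V] {k : ℕ} (hk : finrank F V = k + 1)
    (c : Fin k ↪o TitsBuilding F V) : IsFlag ⊤ (toSeq c) where
  mono := by
    refine monotone_nat_of_le_succ fun j => ?_
    rcases toSeq_cases (k := k) j with rfl | ⟨i, rfl⟩ | h
    · rw [toSeq_zero]
      exact bot_le
    · rcases toSeq_cases (k := k) (i + 1 + 1) with h | ⟨i', h⟩ | h
      · omega
      · rw [h, toSeq_succ, toSeq_succ]
        exact Subtype.coe_le_coe.2 (c.monotone (Fin.le_def.2 (by omega)))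
      · rw [toSeq_of_lt c h]
        exact le_top
    · rw [toSeq_of_lt c (h.trans (Nat.lt_succ_self j))]
      exact le_top
  le _ := le_top
  rank j := by
    rw [finrank_top, hk]
    rcases toSeq_cases (k := k) j with rfl | ⟨i, rfl⟩ | h
    · rw [toSeq_zero, finrank_bot, Nat.zero_min]
    · rw [toSeq_succ, finrank_fullFlag hk]
      omega
    · rw [toSeq_of_lt c h, finrank_top]
      omega

theorem exists_toSeq_eq [FiniteDimensional F V] {k : ℕ} (hk : finrank F V = k + 1)
    {W : ℕ → Submodule F V} (hW : IsFlag ⊤ W) :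
    ∃ c : Fin k ↪o TitsBuilding F V, toSeq c = W := by
  have hr : ∀ j, finrank F (W j) = min j (k + 1) := fun j => by rw [hW.rank, finrank_top, hk]
  have hbot : ∀ i : Fin k, W (i + 1) ≠ ⊥ := fun i h => by
    have := hr (i + 1)
    rw [h, finrank_bot] at this
    omega
  have htop : ∀ i : Fin k, W (i + 1) ≠ ⊤ := fun i h => by
    have := hr (i + 1)
    rw [h, finrank_top, hk] at this
    omega
  refine ⟨OrderEmbedding.ofStrictMono (fun i => ⟨W (i + 1), hbot i, htop i⟩) ?_, ?_⟩
  · intro i i' h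
    refine Subtype.coe_lt_coe.1 (lt_of_le_of_ne (hW.mono (Nat.succ_le_succ h.le)) fun heq => ?_)
    have h1 := hr (i + 1)
    have h2 := hr (i' + 1)
    have h3 : (i : ℕ) < i' := h
    simp only at heq
    rw [heq, h2] at h1
    omega
  · ext j : 1
    rcases toSeq_cases (k := k) j with rfl | ⟨i, rfl⟩ | h
    · rw [toSeq_zero, hW.zero]
    · rw [toSeq_succ]
      rfl
    · rw [toSeq_of_lt _ h, hW.top (by rw [finrank_top, hk]; exact h)]

theorem face_eq_face_iff {k : ℕ} (i : Fin (k + 1)) (c c' : Fin (k + 1) ↪o TitsBuilding F V) :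
    face i c = face i c' ↔ erase (i + 1) (toSeq c) = erase (i + 1) (toSeq c') := by
  rw [erase_eq_erase_iff]
  constructor
  · intro h j hj
    rcases toSeq_cases (k := k + 1) j with rfl | ⟨l, rfl⟩ | hlt
    · rw [toSeq_zero, toSeq_zero]
    · obtain ⟨q, rfl⟩ := Fin.exists_succAbove_eq (x := l) (y := i) fun hl => hj (by rw [hl])
      rw [toSeq_succ, toSeq_succ]
      exact congrArg Subtype.val (DFunLike.congr_fun h q)
    · rw [toSeq_of_lt c hlt, toSeq_of_lt c' hlt]
  · intro h
    ext q : 2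
    have hne : ((i.succAbove q : Fin (k + 1)) : ℕ) + 1 ≠ i + 1 := fun heq =>
      Fin.succAbove_ne i q (Fin.ext (by omega))
    have := h _ hne
    rwa [toSeq_succ, toSeq_succ] at this

theorem mem_cycles_iff [FiniteDimensional F V] {k : ℕ} (hk : finrank F V = k + 1)
    (z : Chains (TitsBuilding F V) k) :
    z ∈ cycles (TitsBuilding F V) k ↔ Finsupp.mapDomain toSeq z ∈ flagCycles ⊤ := by
  classical
  have hsupp : ∀ W ∈ (Finsupp.mapDomain toSeq z).support, IsFlag ⊤ W := by
    intro W hW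
    obtain ⟨c, _, rfl⟩ := Finset.mem_image.1 (Finsupp.mapDomain_support hW)
    exact isFlag_toSeq hk c
  rw [mem_flagCycles, and_iff_right hsupp, finrank_top, hk]
  cases k with
  | zero =>
    exact ⟨fun _ i hi hi' => by omega, fun _ => Submodule.mem_top⟩
  | succ k =>
    change boundary _ k z = 0 ↔ _
    rw [boundary_eq_zero_iff (fun W => finrank F W.1) (finrank_fullFlag hk)]
    constructor
    · intro h i hi hi'
      obtain ⟨i, rfl⟩ : ∃ q, i = q + 1 := ⟨i - 1, by omega⟩
      rw [← Finsupp.mapDomain_comp]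
      exact mapDomain_eq_zero_of_factors
        (fun c c' => (face_eq_face_iff ⟨i, by omega⟩ c c').1) (h ⟨i, by omega⟩)
    · intro h i
      rcases isEmpty_or_nonempty (Fin (k + 1) ↪o TitsBuilding F V) with hempty | ⟨⟨c⟩⟩
      · rw [Subsingleton.elim z 0, Finsupp.mapDomain_zero]
      · have : Nonempty (Fin k ↪o TitsBuilding F V) := ⟨face i c⟩
        have := h (i + 1) (Nat.succ_pos _) (by omega)
        rw [← Finsupp.mapDomain_comp] at this
        exact mapDomain_eq_zero_of_factors (fun c c' => (face_eq_face_iff i c c').2) this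

theorem mapDomain_toSeq_chainMap {k : ℕ} (g : LinearMap.GeneralLinearGroup F V)
    (z : Chains (TitsBuilding F V) k) :
    Finsupp.mapDomain toSeq (chainMap (buildingMap g) k z) =
      act (LinearMap.GeneralLinearGroup.toLinearEquiv g : V →ₗ[F] V)
        (Finsupp.mapDomain toSeq z) := by
  rw [act_apply, ← Finsupp.mapDomain_comp]
  change Finsupp.mapDomain toSeq (Finsupp.mapDomain _ z) = _
  rw [← Finsupp.mapDomain_comp]
  congr 1
  ext c j : 2
  simp only [Function.comp_apply]
  rcases toSeq_cases (k := k) j with rfl | ⟨i, rfl⟩ | h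
  · rw [toSeq_zero, toSeq_zero, Submodule.map_bot]
  · rw [toSeq_succ, toSeq_succ]
    rfl
  · rw [toSeq_of_lt _ h, toSeq_of_lt _ h, Submodule.map_top, LinearEquiv.range]

theorem weightedPairing_mapDomain {α β A : Type*} [AddCommGroup A] {f : α → β}
    (hf : Function.Injective f) (r : A) (x y : α →₀ ℤ) :
    weightedPairing (fun _ => r) (Finsupp.mapDomain f x) (Finsupp.mapDomain f y) =
      weightedPairing (fun _ => r) x y := by
  classical
  refine bilinearMap_ext_on_support (s := Set.univ)
    (f := (weightedPairing fun _ => r).compl₁₂ (Finsupp.lmapDomain ℤ ℤ f)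
      (Finsupp.lmapDomain ℤ ℤ f)) (fun a _ b _ => ?_) (fun _ _ => trivial) (fun _ _ => trivial)
  simp [weightedPairing_single_single, hf.eq_iff]

theorem weightedPairing_const {P A : Type*} [PartialOrder P] [AddCommGroup A] (r : A) {k : ℕ}
    (x y : Chains P k) : weightedPairing (fun _ => r) x y = chainPairing P k x y • r := by
  classical
  refine bilinearMap_ext_on_support (s := Set.univ)
    (g := (chainPairing P k).compr₂ (LinearMap.toSpanSingleton ℤ A r)) (fun a _ b _ => ?_)
    (fun _ _ => trivial) (fun _ _ => trivial)
  rw [LinearMap.compr₂_apply, chainPairing_single, weightedPairing_single_single,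
    Finsupp.single_apply]
  simp [eq_comm]

/-! ### The coinvariants -/

variable (F V)

/-- The classification is applied to the universal invariant form `(x, y) ↦ [x ⊗ y]`, with values in
the coinvariants. -/
theorem exists_tmul_eq_smul [FiniteDimensional F V] [Nontrivial V] :
    ∃ r : ((stRep F V).tprod (stRep F V)).Coinvariants, ∀ x y : St F V,
      Representation.Coinvariants.mk _ (x ⊗ₜ[ℤ] y) = stPairing F V x y • r := by
  classical
  have hk : finrank F V = (finrank F V - 1) + 1 :=
    (Nat.sub_add_cancel (finrank_pos (R := F) (M := V))).symm
  set ρ := (stRep F V).tprod (stRep F V) with hρ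
  let back : flagCycles (⊤ : Submodule F V) → St F V := fun x =>
    ⟨Finsupp.comapDomain toSeq x.1 toSeq_injective.injOn, by
      rw [mem_cycles_iff hk, Finsupp.mapDomain_comapDomain _ toSeq_injective]
      · exact x.2
      · intro W hW
        obtain ⟨c, hc⟩ := exists_toSeq_eq hk ((mem_flagCycles.1 x.2).1 W hW)
        exact ⟨c, hc⟩⟩
  have hback : ∀ x : flagCycles (⊤ : Submodule F V), Finsupp.mapDomain toSeq (back x).1 = x.1 := by
    intro x
    refine Finsupp.mapDomain_comapDomain _ toSeq_injective _ fun W hW => ?_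
    obtain ⟨c, hc⟩ := exists_toSeq_eq hk ((mem_flagCycles.1 x.2).1 W hW)
    exact ⟨c, hc⟩
  have hback_eq : ∀ (x : flagCycles (⊤ : Submodule F V)) (z : St F V),
      Finsupp.mapDomain toSeq z.1 = x.1 → back x = z := fun x z h =>
    Subtype.ext (Finsupp.mapDomain_injective toSeq_injective ((hback x).trans h.symm))
  have hback_add : ∀ x y : flagCycles (⊤ : Submodule F V), back (x + y) = back x + back y :=
    fun x y => hback_eq _ _ (by
      rw [Submodule.coe_add, Finsupp.mapDomain_add, hback, hback, Submodule.coe_add])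
  -- Invariant forms are functions on all chains that are constrained only on cycles, so the value
  -- `0` elsewhere is harmless.
  let B : ((ℕ → Submodule F V) →₀ ℤ) → ((ℕ → Submodule F V) →₀ ℤ) → ρ.Coinvariants := fun x y =>
    if h : x ∈ flagCycles ⊤ ∧ y ∈ flagCycles ⊤ then
      Representation.Coinvariants.mk ρ (back ⟨x, h.1⟩ ⊗ₜ[ℤ] back ⟨y, h.2⟩) else 0
  have hBdef : ∀ {x y} (hx : x ∈ flagCycles ⊤) (hy : y ∈ flagCycles ⊤),
      B x y = Representation.Coinvariants.mk ρ (back ⟨x, hx⟩ ⊗ₜ[ℤ] back ⟨y, hy⟩) :=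
    fun hx hy => dif_pos ⟨hx, hy⟩
  have hB : IsInvariant ⊤ (0 : Dual F V) B := by
    refine ⟨fun x hx x' hx' y hy => ?_, fun x hx y hy y' hy' => ?_,
      fun g t _ hgK hg _ x hx y hy => ?_⟩
    · rw [hBdef (add_mem hx hx') hy, hBdef hx hy, hBdef hx' hy, ← map_add,
        ← TensorProduct.add_tmul, ← hback_add]
      rfl
    · rw [hBdef hx (add_mem hy hy'), hBdef hx hy, hBdef hx hy', ← map_add,
        ← TensorProduct.tmul_add, ← hback_add]
      rfl
    · have hinj : Function.Injective g :=
        (injective_iff_map_eq_zero g).2 fun v => hg v Submodule.mem_top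
      let u : LinearMap.GeneralLinearGroup F V :=
        LinearMap.GeneralLinearGroup.ofLinearEquiv (LinearEquiv.ofInjectiveEndo g hinj)
      have hu : ∀ z (hz : z ∈ flagCycles ⊤) (hz' : act g z ∈ flagCycles ⊤),
          back ⟨act g z, hz'⟩ = stRep F V u (back ⟨z, hz⟩) := fun z hz hz' => by
        refine hback_eq _ _ ?_
        change Finsupp.mapDomain toSeq (chainMap (buildingMap u) _ (back ⟨z, hz⟩).1) = act g z
        rw [mapDomain_toSeq_chainMap, hback]
        rfl
      have hx' := act_mem hgK hg rfl hx
      have hy' := act_mem hgK hg rfl hy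
      rw [hBdef hx' hy', hBdef hx hy, hu x hx, hu y hy]
      exact Representation.Coinvariants.mk_self_apply ρ u (back ⟨x, hx⟩ ⊗ₜ[ℤ] back ⟨y, hy⟩)
  obtain ⟨c, hc⟩ := invariantsArePairings ρ.Coinvariants _ (⊤ : Submodule F V) rfl 0 B hB
  refine ⟨c (finrank F (⊤ : Submodule F V)), fun x y => ?_⟩
  have hx := (mem_cycles_iff hk x.1).1 x.2
  have hy := (mem_cycles_iff hk y.1).1 y.2
  have h := hc _ hx _ hy
  rw [hBdef hx hy, hback_eq _ x rfl, hback_eq _ y rfl] at h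
  rw [h, weightedPairing_congr (w' := fun _ => c (finrank F (⊤ : Submodule F V))) fun W hW => ?_,
    weightedPairing_mapDomain toSeq_injective, weightedPairing_const]
  · rfl
  -- Relative to the zero functional every flag has the maximal position, so the weight is constant.
  · have hflag := (mem_flagCycles.1 hx).1 W hW
    rw [le_antisymm (pos_le _ 0 W) ((hflag.le_ker_iff 0 le_rfl).1 fun v _ => rfl)]

theorem exists_stPairing_eq_one [FiniteDimensional F V] [Nontrivial V] :
    ∃ x y : St F V, stPairing F V x y = 1 := by
  have hk : finrank F V = (finrank F V - 1) + 1 :=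
    (Nat.sub_add_cancel (finrank_pos (R := F) (M := V))).symm
  obtain ⟨a, ha, b, hb, W, hW, hw⟩ := exists_pair (F := F) ℤ _ (⊤ : Submodule F V) rfl
  have hlift : ∀ z ∈ flagCycles (⊤ : Submodule F V),
      ∃ x : St F V, Finsupp.mapDomain toSeq x.1 = z := by
    intro z hz
    have h : Finsupp.mapDomain (toSeq (k := finrank F V - 1))
        (Finsupp.comapDomain toSeq z toSeq_injective.injOn) = z :=
      Finsupp.mapDomain_comapDomain _ toSeq_injective _ fun W hW =>
        exists_toSeq_eq hk ((mem_flagCycles.1 hz).1 W hW)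
    exact ⟨⟨_, (mem_cycles_iff hk _).2 (h.symm ▸ hz)⟩, h⟩
  obtain ⟨x, rfl⟩ := hlift a ha
  obtain ⟨y, rfl⟩ := hlift b hb
  refine ⟨x, y, ?_⟩
  have h := hw fun _ => 1
  rw [weightedPairing_mapDomain toSeq_injective, weightedPairing_const, smul_eq_mul, mul_one] at h
  exact h

theorem coinvariantsPairing_mk (x y : St F V) :
    coinvariantsPairing F V (Representation.Coinvariants.mk _ (x ⊗ₜ[ℤ] y)) =
      stPairing F V x y := rfl

/-- Every class `q` equals its pairing value times `r`, which gives injectivity; a pair of cycles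
with pairing `1` gives surjectivity. -/
theorem coinvariantsPairing_bijective [FiniteDimensional F V] [Nontrivial V] :
    Function.Bijective (coinvariantsPairing F V) := by
  obtain ⟨r, hr⟩ := exists_tmul_eq_smul F V
  obtain ⟨x, y, hxy⟩ := exists_stPairing_eq_one F V
  have hspan : ∀ q, q = coinvariantsPairing F V q • r := by
    intro q
    obtain ⟨t, rfl⟩ := Representation.Coinvariants.mk_surjective _ q
    induction t with
    | zero => simp
    | tmul x y => rw [coinvariantsPairing_mk, hr]
    | add s t hs ht => rw [map_add, map_add, add_smul, ← hs, ← ht]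
  refine ⟨(injective_iff_map_eq_zero _).2 fun q hq => ?_, fun n =>
    ⟨n • Representation.Coinvariants.mk _ (x ⊗ₜ[ℤ] y), ?_⟩⟩
  · rw [hspan q, hq, zero_smul]
  · rw [map_smul, coinvariantsPairing_mk, hxy, smul_eq_mul, mul_one]

end Bridge

end Steinberg

end

theorem theoremA {F : Type*} {V : Type*} [Field F] [AddCommGroup V] [Module F V]
    [FiniteDimensional F V] [Nontrivial V] :
    (∀ A B : Steinberg.FullFlag F V,
      (A = B → Steinberg.chainPairing (Steinberg.TitsBuilding F V) (Module.finrank F V - 1)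
        (Finsupp.single A 1) (Finsupp.single B 1) = 1) ∧
      (A ≠ B → Steinberg.chainPairing (Steinberg.TitsBuilding F V) (Module.finrank F V - 1)
        (Finsupp.single A 1) (Finsupp.single B 1) = 0)) ∧
    (∀ x y : Steinberg.St F V, Steinberg.stPairing F V x y =
      Steinberg.chainPairing (Steinberg.TitsBuilding F V) (Module.finrank F V - 1) x y) ∧
    (∀ (g : LinearMap.GeneralLinearGroup F V) (x y : Steinberg.St F V),
      Steinberg.stPairing F V (Steinberg.stRep F V g x) (Steinberg.stRep F V g y) =
        Steinberg.stPairing F V x y) ∧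
    (∀ x y : Steinberg.St F V,
      Steinberg.coinvariantsPairing F V (Representation.Coinvariants.mk _ (x ⊗ₜ[ℤ] y)) =
        Steinberg.stPairing F V x y) ∧
    Function.Bijective (Steinberg.coinvariantsPairing F V) := by
  classical
  refine ⟨fun A B => ⟨?_, fun h => ?_⟩, fun _ _ => rfl, Steinberg.stPairing_invariant F V,
    Steinberg.coinvariantsPairing_mk F V, Steinberg.coinvariantsPairing_bijective F V⟩
  · rintro rfl
    simp [Steinberg.chainPairing_single]
  · rw [Steinberg.chainPairing_single, Finsupp.single_apply, if_neg h.symm, mul_zero]
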